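/- **Setting.** Let $A$ and $B$ be free groups with fixed bases $X$ and $Y$, let $C$ be a finitely generated group with monomorphisms $\varphi:C\to A$, $\psi:C\to B$, and let $z_1,\dots,z_n$ be generators of $C$; put $u_i=\varphi(z_i)$, $v_i=\psi(z_i)$. Write $|\cdot|$ for the length of reduced words. Let $S\ni 1$ and $T\ni 1$ be systems of right coset representatives of $\varphi(C)$ in $A$ and of $\psi(C)$ in $B$, all of whose elements have minimal length in their coset. *Coset algorithms.* A coset algorithm for $A$ writes an input $g\in A$ (a reduced word) as $g=cs$ with $s\in S$ and $c$ in the subgroup, $c$ being returned as a word in the generators $u_i^{\pm1}$; likewise for $B$. Its time is at least the length of its output (number of letters $u_i^{\pm1}$ plus $|s|$). It is linear with constant $L$ if its time on $g$ is at most $L(|g|+1)$. *Algorithm II* (relative to coset algorithms for $A$ and $B$). The input is an alternating product $w=g_1\cdots g_k$ of nontrivial reduced words in $X$ or in $Y$; $k$ is its syllable length and $|w|=\sum|g_i|$. The syllables are treated from right to left, starting with $c=1$ and the empty normal form tail. When $g_i$ is treated, $c$ is a word in the generators of $C$ and the tail is $t_1\cdots t_m$. Rewrite $c$ in the generators of the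 factor of $g_i$ (by $u_j\leftrightarrow v_j$) and split $g_ic=c_1s$ by the coset algorithm. If $s=1$, drop the syllable and continue with $c_1$. If $s\ne1$ and $t_1$ is absent or lies in the other factor, put $s$ in front of the tail and continue with $c_1$. If $s\neq 1$ and $t_1$ lies in the same factor, split $st_1=c_2s'$ by the coset algorithm, replace $t_1$ by $s'$ (delete it if $s'=1$), and continue with $c_1c_2$. After $g_1$, the output is $c\,t_1\cdots t_m$. The time is the number of steps: the times of all calls of the coset algorithms, plus one step per split and one step for each letter of $g_i$, $s$, $t_1$ and of the word for $c$ that is read, and each letter that is written when the generators in $c$ are replaced by the reduced words $u_j^{\pm1}$, respectively $v_j^{\pm1}$. *Constants.* Call $\lambda\ge1$ a rewriting factor if $|\psi(c)|\le\lambda|\varphi(c)|$ and $|\varphi(c)|\le\lambda|\psi(c)|$ for all $c\in C$. Call an integer $M\geq 0$ an offset for $S,T$ if $|\varphi(c)|\le|\varphi(c)s|+M$ for all $c\in C$, $s\in S$, and $|\psi(c)|\le|\psi(c)t|+M$ for all $c\in C$, $t\in T$. **Theorem.** (1) For all data as above, rewriting factors, minimal-length systems $S,T$, offsets for each such $S,T$,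 and linear coset algorithms for each such $S,T$ exist. If $n\ge1$, all $z_i\ne1$, and every $c\in C$ has an expression as a word in the $z_i^{\pm1}$ for which no letters cancel when the words $u_i^{\pm1}$, and also when the words $v_i^{\pm1}$, are substituted, then $$\lambda=\max\left\{\frac{\max_i|u_i|}{\min_i|v_i|},\ \frac{\max_i|v_i|}{\min_i|u_i|}\right\}$$ is a rewriting factor. For all minimal-length $S,T$ and every $L$ there is a constant $L_1$ such that, for every rewriting factor $\lambda$ and every offset $M$, Algorithm II with linear coset algorithms of constant $L$ spends on every input $w$ of syllable length $k$ at most $$k\cdot L_1\cdot|w|\cdot\lambda^k\cdot(|w|+M)$$ steps. This is at most exponential in the length of the input: there is a constant $E$, independent of $w$ and of the coset algorithms, such that the time is at most $E^{|w|}$. (2) There are free groups $A$, $B$ and $C$ of finite rank with embeddings of $C$ in $A$ and $B$, systems $S$, $T$ as above (of minimal length, containing $1$) that are recursive, a rewriting factor $\lambda>1$, and constants $\varepsilon>0$, $K$ such that for every $k\ge1$ there is an input $w$ of syllable length $k$ and length $|w|\le Kk$ on which Algorithm II, with any coset algorithms for $S$, $T$ and the images of a basis of $C$, takes at least $\varepsilon\lambda^k$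 steps. So the exponential bound in (1) is attained with the same base $\lambda$. -/

import Mathlib

open Monoid.PushoutI.NormalWord (Transversal)

namespace AmalgamNF

/-- The element of `G` spelled by a word in the letters `g i` and their inverses
(the letter `(i, true)` stands for `g i`, the letter `(i, false)` for its inverse). -/
def evalWord {ι G : Type*} [Group G] (g : ι → G) (z : List (ι × Bool)) : G :=
  FreeGroup.lift g (FreeGroup.mk z)

/-- The number of letters written down when every letter of `z` is replaced by the reduced word
`u i` (or its inverse), before any free reduction. -/
def substLength {ι X : Type*} [DecidableEq X] (u : ι → FreeGroup X) (z : List (ι × Bool)) : ℕ :=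
  (z.map fun p => (u p.1).norm).sum

/-- A solution, together with its time function, of the membership search and coset representative
search problems in the free group on `X`, for the subgroup generated by the `u i` and for the set
`S` of right coset representatives: the input `g` is written as `g = c * s`, where `s ∈ S` and `c`
is returned as a word in the given generators. An algorithm needs at least one step for
each letter of its output. -/
structure CosetAlgorithm {ι X : Type*} [DecidableEq X] (u : ι → FreeGroup X)
    (S : Set (FreeGroup X)) where
  /-- the subgroup part, as a word in the generators -/
  word : FreeGroup X → List (ι × Bool)
  /-- the coset representative -/
  rep : FreeGroup X → FreeGroup X
  /-- the number of steps -/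
  time : FreeGroup X → ℕ
  rep_mem : ∀ g, rep g ∈ S
  spec : ∀ g, evalWord u (word g) * rep g = g
  output_le_time : ∀ g, (word g).length + (rep g).norm ≤ time g

/-- A syllable: a reduced word over one of the two alphabets `X false`, `X true`. -/
abbrev Syllable (X : Bool → Type*) := Σ b : Bool, FreeGroup (X b)

/-- `w = g₁ ⋯ gₖ` is a product of nontrivial reduced words, taken alternately from the two
factors. These products are the elements of the free group on the union of both alphabets. -/
def IsInput {X : Bool → Type*} (w : List (Syllable X)) : Prop :=
  w.IsChain (fun x y => x.1 ≠ y.1) ∧ ∀ x ∈ w, x.2 ≠ 1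

/-- The length `|w|` of `w = g₁ ⋯ gₖ`, the number of letters. -/
def inputLength {X : Bool → Type*} [∀ b, DecidableEq (X b)] (w : List (Syllable X)) : ℕ :=
  (w.map fun x => x.2.norm).sum

section Algorithm

variable {X : Bool → Type*} [∀ b, DecidableEq (X b)] {ι : Type*}
  {u : ∀ b, ι → FreeGroup (X b)} {S : ∀ b, Set (FreeGroup (X b))}

/-- The main loop of the normal form algorithm. A state consists of the syllables `gᵢ, …, g₁` not
yet treated (last one first), of the element `c` of the amalgamated subgroup that is to be
multiplied to `gᵢ` from the right, given as a word `z` in the generators, and of the part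
`uᵢ₊₁ ⋯ uₘ` that is already in normal form. The value is the output `(c, u₁ ⋯ uₘ)` and the number
of steps.

One round rewrites `c` in the generators of the factor of `gᵢ`, multiplies, and
splits `gᵢ c = c₁ s` by the coset algorithm. If `s = 1` the syllable disappears. If `s ≠ 1` and
`uᵢ₊₁` lies in the same factor, then `s uᵢ₊₁ = c₂ s'` is split as well, and `s'` replaces
`uᵢ₊₁`, or nothing does when `s' = 1`. Otherwise `s` is put before `uᵢ₊₁`.
Each round costs one step, one step for each letter that is read or written, and the time
of the calls of the coset algorithm. -/
def run (P : ∀ b, CosetAlgorithm (u b) (S b)) :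
    List (Syllable X) → List (ι × Bool) → List (Syllable X) →
      (List (ι × Bool) × List (Syllable X)) × ℕ
  | [], z, tail => ((z, tail), 0)
  | ⟨b, g⟩ :: rest, z, tail =>
    let h := g * evalWord (u b) z
    let z₁ := (P b).word h
    let s := (P b).rep h
    let cost := 1 + z.length + substLength (u b) z + g.norm + (P b).time h
    if s = 1 then
      let r := run P rest z₁ tail
      (r.1, cost + r.2)
    else
      match tail with
      | [] =>
        let r := run P rest z₁ [⟨b, s⟩]
        (r.1, cost + r.2)
      | ⟨b', t⟩ :: tail' =>
        if e : b' = b then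
          let y := s * (e ▸ t)
          let z₂ := (P b).word y
          let s' := (P b).rep y
          let cost' := 1 + s.norm + t.norm + (P b).time y
          if s' = 1 then
            let r := run P rest (z₁ ++ z₂) tail'
            (r.1, cost + cost' + r.2)
          else
            let r := run P rest (z₁ ++ z₂) (⟨b, s'⟩ :: tail')
            (r.1, cost + cost' + r.2)
        else
          let r := run P rest z₁ (⟨b, s⟩ :: ⟨b', t⟩ :: tail')
          (r.1, cost + r.2)

/-- The normal form algorithm: output and number of steps on the input `w = g₁ ⋯ gₖ`. -/
def normalFormAlgorithm (P : ∀ b, CosetAlgorithm (u b) (S b)) (w : List (Syllable X)) :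
    (List (ι × Bool) × List (Syllable X)) × ℕ :=
  run P w.reverse [] []

/-- The number of steps of the normal form algorithm on the input `w = g₁ ⋯ gₖ`. -/
def time (P : ∀ b, CosetAlgorithm (u b) (S b)) (w : List (Syllable X)) : ℕ :=
  (normalFormAlgorithm P w).2

/-- The coset algorithms run in linear time, with constant `L`. -/
def LinearTime (P : ∀ b, CosetAlgorithm (u b) (S b)) (L : ℕ) : Prop :=
  ∀ b g, (P b).time g ≤ L * (g.norm + 1)

end Algorithm

section Constants

variable {X : Bool → Type*} [∀ b, DecidableEq (X b)] {C : Type*} [Group C]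
  {φ : ∀ b, C →* FreeGroup (X b)}

/-- Every representative has minimal length in its right coset. -/
def IsMinimal (d : Transversal φ) : Prop :=
  ∀ b, ∀ s ∈ d.set b, ∀ c, s.norm ≤ (φ b c * s).norm

/-- If `w = c s` with `c` in the amalgamated subgroup and `s` a representative, then
`|c| ≤ |w| + M`. -/
def IsOffset (d : Transversal φ) (M : ℕ) : Prop :=
  ∀ b, ∀ s ∈ d.set b, ∀ c, (φ b c).norm ≤ (φ b c * s).norm + M

/-- Passing from the word of `c` in one factor to its word in the other factor increases the
length at most by the factor `lam ≥ 1`. -/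
def IsRewritingFactor (φ : ∀ b, C →* FreeGroup (X b)) (lam : ℝ) : Prop :=
  1 ≤ lam ∧ ∀ b c, ((φ b c).norm : ℝ) ≤ lam * ((φ (!b) c).norm : ℝ)

/-- The maximum of `max |uᵢ| / min |vᵢ|` and `max |vᵢ| / min |uᵢ|`, where `uᵢ` and `vᵢ` are the
words of the given generators in the two factors. -/
noncomputable def generatorRatio (φ : ∀ b, C →* FreeGroup (X b)) {ι : Type*} (gen : ι → C) : ℝ :=
  let ratio (b : Bool) : ℝ :=
    (⨆ i, ((φ b (gen i)).norm : ℝ)) / (⨅ i, ((φ (!b) (gen i)).norm : ℝ))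
  max (ratio false) (ratio true)

/-- Every `c` is the value of a word in the generators such that, in both factors, no letters cancel
when the generators are substituted. -/
def NoCancellation (φ : ∀ b, C →* FreeGroup (X b)) {ι : Type*} (gen : ι → C) : Prop :=
  ∀ c, ∃ z, evalWord gen z = c ∧ ∀ b, substLength (fun i => φ b (gen i)) z = (φ b c).norm

end Constants

/-- A set of elements of the free group on `n` letters is recursive. -/
def IsRecursive {n : ℕ} (S : Set (FreeGroup (Fin n))) : Prop :=
  ComputablePred fun l : List (Fin n × Bool) => FreeGroup.mk l ∈ S

end AmalgamNF

namespace AmalgamNF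

/-! The upper bound rests on two properties of a finitely generated subgroup H of a free group.
Every prefix of a reduced word of H lies in H·r with r in a finite set (`mk_prefix_toWord`). Hence H
is undistorted (`exists_evalWord_length_le`), which yields rewriting factors and linear coset
algorithms. Moreover only boundedly many letters cancel between c in H and a minimal representative
s, so |c| + |s| ≤ |cs| + 2N (`norm_add_norm_le`).

The quantity to follow is |c| + |tail|, with c measured in the factor of the syllable g being
treated. A round contains at most two splits, so it adds at most |g| + 4N (`run_cons_bound`).
Passing to the other factor multiplies by at most λ. Iterating over k syllables gives λ^k
(`run_le`).

For the lower bound, the two basis elements of C have images xy and yxyx in one factor, and the same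
two words interchanged in the other. Because x·(yxyx)^N = (xy)^(2N)·x, a syllable x turns c =
(yxyx)^N into (xy)^(2N), which is (yxyx)^(2N) in the other factor. So the exponent doubles in every
round, and λ = 2. A spanning tree of the coset graph of ⟨xy, yxyx⟩ supplies minimal, recursive
representatives that contain x. -/

theorem prefix_append_cases {α : Type*} {p A B : List α} (h : p <+: A ++ B) :
    p <+: A ∨ ∃ t, p = A ++ t ∧ t <+: B := by
  rcases List.prefix_or_prefix_of_prefix h (List.prefix_append A B) with h' | ⟨t, rfl⟩
  · exact Or.inl h'
  · exact Or.inr ⟨t, rfl, (List.prefix_append_right_inj A).1 h⟩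

/-! ### Cancellation in products and prefixes under free reduction. -/

section FreeGroupLemmas

open FreeGroup

/-- Here q is the part of the left factor that cancels. It is found by comparing the last letter of
`L₁` with the first letter of `L₂` until they are no longer inverse. -/
theorem exists_cancellation {α : Type*} (L₂ : List (α × Bool)) (h₂ : IsReduced L₂)
    (L₁ : List (α × Bool)) (h₁ : IsReduced L₁) :
    ∃ p q r, L₁ = p ++ q ∧ L₂ = invRev q ++ r ∧ IsReduced (p ++ r) := by
  induction L₁ using List.reverseRecOn generalizing L₂ with
  | nil => exact ⟨[], [], L₂, by simp, by simp, by simpa using h₂⟩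
  | append_singleton L x ih =>
    cases L₂ with
    | nil => exact ⟨L ++ [x], [], [], by simp, by simp, by simpa using h₁⟩
    | cons y L' =>
      by_cases hxy : x.1 = y.1 → x.2 = y.2
      · refine ⟨L ++ [x], [], y :: L', by simp, by simp, ?_⟩
        rw [FreeGroup.IsReduced, List.isChain_append]
        exact ⟨h₁, h₂, by simpa using hxy⟩
      · obtain ⟨p, q, r, rfl, rfl, h⟩ := ih L' h₂.of_cons (List.IsChain.left_of_append h₁)
        refine ⟨p, q ++ [x], r, by simp, ?_, h⟩
        push Not at hxy
        obtain ⟨x₁, x₂⟩ := x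
        obtain ⟨y₁, y₂⟩ := y
        obtain ⟨rfl, h2⟩ := hxy
        have : y₂ = !x₂ := by revert h2; cases x₂ <;> cases y₂ <;> simp
        simp [invRev, this]

/-- A reduction step deletes a pair of inverse letters. A prefix reaching beyond the gap becomes a
prefix of the longer word, with the same value, once the pair is put back. -/
theorem exists_prefix_of_red {α : Type*} {L₁ L₂ p : List (α × Bool)} (h : Red L₁ L₂)
    (hp : p <+: L₂) : ∃ p', p' <+: L₁ ∧ mk p' = mk p := by
  induction h generalizing p with
  | refl => exact ⟨p, hp, rfl⟩
  | @tail M _ _ hs ih =>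
    obtain ⟨p', hp', he⟩ : ∃ p', p' <+: M ∧ mk p' = mk p := by
      obtain @⟨A, B, x, b⟩ := hs
      rcases prefix_append_cases hp with h | ⟨t, rfl, ht⟩
      · exact ⟨p, h.trans (List.prefix_append _ _), rfl⟩
      · refine ⟨A ++ (x, b) :: (x, !b) :: t, ?_, Quot.sound Red.Step.not⟩
        simpa using ht
    obtain ⟨p'', h1, h2⟩ := ih hp'
    exact ⟨p'', h1, h2.trans he⟩

end FreeGroupLemmas

/-! ### Values of words in given generators. -/

section Words

variable {ι G : Type*} [Group G]

/-- The value of a single letter. -/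
def letterValue (g : ι → G) (p : ι × Bool) : G := cond p.2 (g p.1) (g p.1)⁻¹

theorem evalWord_eq_prod (g : ι → G) (z : List (ι × Bool)) :
    evalWord g z = (z.map (letterValue g)).prod := FreeGroup.lift_mk

@[simp] theorem evalWord_nil (g : ι → G) : evalWord g [] = 1 := by simp [evalWord_eq_prod]

@[simp] theorem evalWord_cons (g : ι → G) (p : ι × Bool) (z : List (ι × Bool)) :
    evalWord g (p :: z) = letterValue g p * evalWord g z := by simp [evalWord_eq_prod]

@[simp] theorem evalWord_append (g : ι → G) (z z' : List (ι × Bool)) :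
    evalWord g (z ++ z') = evalWord g z * evalWord g z' := by simp [evalWord_eq_prod]

theorem evalWord_invRev (g : ι → G) (z : List (ι × Bool)) :
    evalWord g (FreeGroup.invRev z) = (evalWord g z)⁻¹ := by
  rw [evalWord, ← FreeGroup.inv_mk, map_inv, evalWord]

theorem map_evalWord {H : Type*} [Group H] (f : G →* H) (g : ι → G) (z : List (ι × Bool)) :
    f (evalWord g z) = evalWord (fun i => f (g i)) z := by
  induction z with
  | nil => simp
  | cons p z ih => obtain ⟨i, b⟩ := p; cases b <;> simp [ih, letterValue]

theorem exists_evalWord {g : ι → G} (hg : Subgroup.closure (Set.range g) = ⊤) (c : G) :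
    ∃ z, evalWord g z = c := by
  obtain ⟨x, rfl⟩ := FreeGroup.lift_surjective_iff_closure_range_eq_top.2 hg c
  obtain ⟨z, rfl⟩ := Quot.exists_rep x
  exact ⟨z, rfl⟩

/-- One spelling is fixed for each element of `D` that has one; elements outside the subgroup do not
matter. -/
theorem exists_length_bound_of_finite (u : ι → G) {D : Set G}
    (hD : D.Finite) :
    ∃ K, ∀ z, evalWord u z ∈ D → ∃ z', evalWord u z' = evalWord u z ∧ z'.length ≤ K := by
  induction D, hD using Set.Finite.induction_on with
  | empty => exact ⟨0, by simp⟩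
  | @insert d D _ _ ih =>
    obtain ⟨K, hK⟩ := ih
    by_cases hd : ∃ z, evalWord u z = d
    · obtain ⟨z₀, rfl⟩ := hd
      refine ⟨max K z₀.length, fun z hz => ?_⟩
      rcases hz with hz | hz
      · exact ⟨z₀, hz.symm, le_max_right _ _⟩
      · obtain ⟨z', h, hl⟩ := hK z hz
        exact ⟨z', h, hl.trans (le_max_left _ _)⟩
    · refine ⟨K, fun z hz => hK z ?_⟩
      rcases hz with hz | hz
      · exact (hd ⟨z, hz⟩).elim
      · exact hz

end Words

/-! ### Quasiconvexity and undistortedness of finitely generated subgroups. -/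

section Undistorted

variable {ι X : Type*} [DecidableEq X]

theorem norm_letterValue (u : ι → FreeGroup X) (p : ι × Bool) :
    (letterValue u p).norm = (u p.1).norm := by
  obtain ⟨i, b⟩ := p; cases b <;> simp [letterValue]

theorem norm_evalWord_le (u : ι → FreeGroup X) (z : List (ι × Bool)) :
    (evalWord u z).norm ≤ substLength u z := by
  induction z with
  | nil => simp
  | cons p z ih =>
    rw [evalWord_cons]
    refine (FreeGroup.norm_mul_le _ _).trans ?_
    simp only [substLength, List.map_cons, List.sum_cons, norm_letterValue] at ih ⊢
    lia

theorem substLength_le {u : ι → FreeGroup X} {U : ℕ} (hU : ∀ i, (u i).norm ≤ U)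
    (z : List (ι × Bool)) : substLength u z ≤ U * z.length := by
  induction z with
  | nil => simp [substLength]
  | cons p z ih =>
    simp only [substLength, List.map_cons, List.sum_cons, List.length_cons] at ih ⊢
    have := hU p.1
    lia

theorem exists_norm_le [Finite ι] (u : ι → FreeGroup X) : ∃ U, ∀ i, (u i).norm ≤ U := by
  obtain ⟨U, hU⟩ := (Set.finite_range fun i => (u i).norm).bddAbove
  exact ⟨U, fun i => hU ⟨i, rfl⟩⟩

/-- The concatenation of the reduced words substituted for the letters. -/
def expand (u : ι → FreeGroup X) (z : List (ι × Bool)) : List (X × Bool) :=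
  z.flatMap fun p => (letterValue u p).toWord

theorem mk_expand (u : ι → FreeGroup X) (z : List (ι × Bool)) :
    FreeGroup.mk (expand u z) = evalWord u z := by
  induction z with
  | nil => rfl
  | cons p z ih =>
    rw [expand, List.flatMap_cons, ← FreeGroup.mul_mk, FreeGroup.mk_toWord, evalWord_cons, ← ih]
    rfl

/-- The values of the prefixes of the generators and of their inverses. -/
def segments (u : ι → FreeGroup X) : Set (FreeGroup X) :=
  insert 1 (⋃ p : ι × Bool, FreeGroup.mk '' {q | q <+: (letterValue u p).toWord})

theorem finite_segments [Finite ι] (u : ι → FreeGroup X) : (segments u).Finite := by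
  refine (Set.finite_iUnion fun p => Set.Finite.image _ ?_).insert _
  refine (List.finite_toSet (letterValue u p).toWord.inits).subset fun q hq => ?_
  simpa using hq

theorem mk_prefix_expand (u : ι → FreeGroup X) (z : List (ι × Bool)) (p : List (X × Bool))
    (hp : p <+: expand u z) :
    ∃ z₀, ∃ r ∈ segments u, FreeGroup.mk p = evalWord u z₀ * r := by
  induction z generalizing p with
  | nil =>
    obtain rfl : p = [] := by simpa [expand] using hp
    exact ⟨[], 1, Set.mem_insert _ _, by rw [← FreeGroup.one_eq_mk]; simp⟩
  | cons a z ih =>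
    rw [expand, List.flatMap_cons] at hp
    rcases prefix_append_cases hp with h | ⟨t, rfl, ht⟩
    · exact ⟨[], _, Set.mem_insert_of_mem _ (Set.mem_iUnion.2 ⟨a, p, h, rfl⟩), by simp⟩
    · obtain ⟨z₀, r, hr, he⟩ := ih t ht
      refine ⟨a :: z₀, r, hr, ?_⟩
      rw [← FreeGroup.mul_mk, he, FreeGroup.mk_toWord, evalWord_cons, mul_assoc]

theorem red_expand (u : ι → FreeGroup X) (z : List (ι × Bool)) :
    FreeGroup.Red (expand u z) (evalWord u z).toWord := by
  rw [← mk_expand, FreeGroup.toWord_mk]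
  exact FreeGroup.reduce.red

/-- Quasiconvexity: every prefix of an element of the subgroup lies near the subgroup. -/
theorem mk_prefix_toWord (u : ι → FreeGroup X) (z : List (ι × Bool)) (p : List (X × Bool))
    (hp : p <+: (evalWord u z).toWord) :
    ∃ z₀, ∃ r ∈ segments u, FreeGroup.mk p = evalWord u z₀ * r := by
  obtain ⟨p', h, he⟩ := exists_prefix_of_red (red_expand u z) hp
  rw [← he]
  exact mk_prefix_expand u z p' h

/-- The letters occurring in the generators and in their inverses. -/
def letters (u : ι → FreeGroup X) : Set (X × Bool) :=
  ⋃ p : ι × Bool, {x | x ∈ (letterValue u p).toWord}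

theorem finite_letters [Finite ι] (u : ι → FreeGroup X) : (letters u).Finite :=
  Set.finite_iUnion fun p => List.finite_toSet (letterValue u p).toWord

theorem mem_letters_of_mem_toWord (u : ι → FreeGroup X) (z : List (ι × Bool)) {x : X × Bool}
    (hx : x ∈ (evalWord u z).toWord) : x ∈ letters u := by
  have := (red_expand u z).sublist.subset hx
  simp only [expand, List.mem_flatMap] at this
  obtain ⟨a, -, ha⟩ := this
  exact Set.mem_iUnion.2 ⟨a, ha⟩

/-- Finitely generated subgroups of free groups are undistorted. -/
theorem exists_evalWord_length_le [Finite ι] (u : ι → FreeGroup X) :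
    ∃ K, ∀ z, ∃ z', evalWord u z' = evalWord u z ∧ z'.length ≤ K * (evalWord u z).norm := by
  have hR := finite_segments u
  -- If consecutive prefixes p and px lie in H·r and H·r₀, their H-parts differ by r·x·r₀⁻¹. There
  -- are finitely many such elements, so each letter of the reduced word costs at most K generators.
  -- The segments themselves are included for the correction at the end of the word.
  have hD : (segments u ∪ Set.image2 (fun a r => a * r⁻¹)
      (Set.image2 (fun r x => r * FreeGroup.mk [x]) (segments u) (letters u))
      (segments u)).Finite := hR.union (Set.Finite.image2 _ (hR.image2 _ (finite_letters u)) hR)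
  obtain ⟨K, hK⟩ := exists_length_bound_of_finite u hD
  have key : ∀ z p, p <+: (evalWord u z).toWord →
      ∃ z', ∃ r ∈ segments u, FreeGroup.mk p = evalWord u z' * r ∧ z'.length ≤ K * p.length := by
    intro z p hp
    induction p using List.reverseRecOn with
    | nil => exact ⟨[], 1, Set.mem_insert _ _, by rw [← FreeGroup.one_eq_mk]; simp, by simp⟩
    | append_singleton p x ih =>
      obtain ⟨z', r, hr, he, hl⟩ := ih ((List.prefix_append _ _).trans hp)
      obtain ⟨z₀, r₀, hr₀, he₀⟩ := mk_prefix_toWord u z _ hp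
      have hx : x ∈ letters u := mem_letters_of_mem_toWord u z (hp.subset (by simp))
      have hv : evalWord u (FreeGroup.invRev z' ++ z₀) = r * FreeGroup.mk [x] * r₀⁻¹ := by
        rw [← FreeGroup.mul_mk, he] at he₀
        rw [evalWord_append, evalWord_invRev, eq_mul_inv_iff_mul_eq, mul_assoc, ← he₀]
        group
      obtain ⟨z₁, h₁, hl₁⟩ := hK (FreeGroup.invRev z' ++ z₀) (Or.inr
        ⟨_, ⟨r, hr, x, hx, rfl⟩, r₀, hr₀, hv.symm⟩)
      refine ⟨z' ++ z₁, r₀, hr₀, ?_, ?_⟩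
      · rw [he₀, evalWord_append, h₁, evalWord_append, evalWord_invRev]
        group
      · simp only [List.length_append, List.length_singleton]
        lia
  -- The last remainder r lies in the subgroup and costs another K, which is at most K·|g| unless g
  -- = 1.
  refine ⟨2 * K, fun z => ?_⟩
  rcases Nat.eq_zero_or_pos (evalWord u z).norm with h0 | h0
  · exact ⟨[], by rw [FreeGroup.norm_eq_zero.1 h0, evalWord_nil], by simp⟩
  obtain ⟨z', r, hr, he, hl⟩ := key z _ List.prefix_rfl
  rw [FreeGroup.mk_toWord] at he
  have hv : evalWord u (FreeGroup.invRev z' ++ z) = r := by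
    rw [evalWord_append, evalWord_invRev, he]
    group
  obtain ⟨z₁, h₁, hl₁⟩ := hK _ (Or.inl (hv ▸ hr))
  refine ⟨z' ++ z₁, by rw [evalWord_append, h₁, hv, he], ?_⟩
  have : z'.length ≤ K * (evalWord u z).norm := hl
  have : K ≤ K * (evalWord u z).norm := Nat.le_mul_of_pos_right _ h0
  rw [List.length_append, mul_assoc]
  lia

/-- Little cancels in the product of an element of the subgroup and a minimal representative. -/
theorem norm_add_norm_le {u : ι → FreeGroup X} {N : ℕ} (hN : ∀ r ∈ segments u, r.norm ≤ N)
    {s : FreeGroup X} (hs : ∀ z, s.norm ≤ (evalWord u z * s).norm) (z : List (ι × Bool)) :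
    (evalWord u z).norm + s.norm ≤ (evalWord u z * s).norm + 2 * N := by
  obtain ⟨p, q, t, hc, hst, hred⟩ := exists_cancellation _ s.isReduced_toWord _
    (evalWord u z).isReduced_toWord
  obtain ⟨z₀, r, hr, he⟩ := mk_prefix_toWord u z p (hc ▸ List.prefix_append _ _)
  have hc' : evalWord u z = FreeGroup.mk p * FreeGroup.mk q := by
    rw [FreeGroup.mul_mk, ← hc, FreeGroup.mk_toWord]
  have hs' : s = (FreeGroup.mk q)⁻¹ * FreeGroup.mk t := by
    rw [FreeGroup.inv_mk, FreeGroup.mul_mk, ← hst, FreeGroup.mk_toWord]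
  have hcs : (evalWord u z * s).norm = p.length + t.length := by
    rw [hc', hs', mul_assoc, mul_inv_cancel_left, FreeGroup.mul_mk, FreeGroup.norm,
      FreeGroup.toWord_mk, hred.reduce_eq, List.length_append]
  have h1 : (evalWord u z).norm = p.length + q.length := by
    rw [FreeGroup.norm, hc, List.length_append]
  have h2 : s.norm = q.length + t.length := by
    rw [FreeGroup.norm, hst, List.length_append, FreeGroup.invRev_length]
  -- With c = pq, s = q⁻¹t and p = hr for some h in the subgroup, h⁻¹cs = rt lies in the coset of s.
  -- Minimality of s therefore bounds the cancelled part q by N.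
  have h3 : s.norm ≤ N + t.length := by
    refine (hs (FreeGroup.invRev z₀ ++ z)).trans ?_
    have : evalWord u (FreeGroup.invRev z₀ ++ z) * s = r * FreeGroup.mk t := by
      rw [evalWord_append, evalWord_invRev, hc', hs', he]
      group
    rw [this]
    exact (FreeGroup.norm_mul_le _ _).trans (add_le_add (hN r hr) FreeGroup.norm_mk_le)
  lia

end Undistorted

/-! ### Existence of representatives, rewriting factors, offsets and linear coset algorithms. -/

section Constants

variable {X : Bool → Type*} [∀ b, DecidableEq (X b)] {C : Type*} [Group C]
  {φ : ∀ b, C →* FreeGroup (X b)}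

theorem exists_isMinimal (hφ : ∀ b, Function.Injective (φ b)) :
    ∃ d : Transversal φ, IsMinimal d := by
  have h : ∀ b, ∀ q : Quotient (QuotientGroup.rightRel (φ b).range), ∃ g : FreeGroup (X b),
      Quotient.mk'' g = q ∧ ∀ g', Quotient.mk'' g' = q → g.norm ≤ g'.norm := by
    intro b q
    obtain ⟨g₀, hg₀⟩ := Quotient.exists_rep q
    obtain ⟨g, hg, hmin⟩ := (measure (FreeGroup.norm (α := X b))).wf.has_min
      {g | Quotient.mk'' g = q} ⟨g₀, hg₀⟩
    exact ⟨g, hg, fun g' hg' => not_lt.1 (hmin g' hg')⟩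
  choose rep hrep hmin using h
  refine ⟨⟨hφ, fun b => Set.range (rep b), fun b => ⟨Quotient.mk'' 1, ?_⟩,
    fun b => Subgroup.isComplement_range_right (hrep b)⟩, ?_⟩
  -- The trivial coset contains an element of length 0, so its shortest element is 1.
  · have := hmin b (Quotient.mk'' 1) 1 rfl
    rwa [FreeGroup.norm_one, Nat.le_zero, FreeGroup.norm_eq_zero] at this
  · rintro b _ ⟨q, rfl⟩ c
    refine hmin b q _ ?_
    rw [← hrep b q, Quotient.eq'', QuotientGroup.rightRel_apply, hrep b q]
    exact ⟨c⁻¹, by simp⟩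

variable {ι : Type*} {gen : ι → C}

theorem exists_isRewritingFactor [Finite ι] (hφ : ∀ b, Function.Injective (φ b))
    (hgen : Subgroup.closure (Set.range gen) = ⊤) : ∃ lam : ℝ, IsRewritingFactor φ lam := by
  choose K hK using fun b => exists_evalWord_length_le fun i => φ b (gen i)
  choose U hU using fun b => exists_norm_le fun i => φ b (gen i)
  have h : ∀ b c, (φ b c).norm ≤ U b * K (!b) * (φ (!b) c).norm := by
    intro b c
    obtain ⟨z, rfl⟩ := exists_evalWord hgen c
    obtain ⟨z', h, hl⟩ := hK (!b) z
    rw [← h] at hl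
    rw [← map_evalWord, ← map_evalWord] at h
    rw [← hφ _ h, map_evalWord, map_evalWord, mul_assoc]
    exact ((norm_evalWord_le _ _).trans (substLength_le (hU b) z')).trans
      (Nat.mul_le_mul_left _ hl)
  refine ⟨max 1 (max (U false * K true) (U true * K false)), le_max_left _ _, fun b c => ?_⟩
  have hb : ((U b * K (!b) : ℕ) : ℝ) ≤ max 1 (max (U false * K true) (U true * K false)) := by
    cases b <;> simp
  calc ((φ b c).norm : ℝ) ≤ ((U b * K (!b) : ℕ) : ℝ) * (φ (!b) c).norm := by
        exact_mod_cast h b c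
    _ ≤ _ := by gcongr; exact_mod_cast hb

theorem isRewritingFactor_generatorRatio [Finite ι] [Nonempty ι]
    (hφ : ∀ b, Function.Injective (φ b)) (h1 : ∀ i, gen i ≠ 1) (hgen : NoCancellation φ gen) :
    IsRewritingFactor φ (generatorRatio φ gen) := by
  let f (b : Bool) (i : ι) : ℝ := (φ b (gen i)).norm
  have hpos : ∀ b i, 0 < f b i := fun b i => by
    have : (φ b (gen i)).norm ≠ 0 := by
      rw [Ne, FreeGroup.norm_eq_zero, map_eq_one_iff _ (hφ b)]
      exact h1 i
    exact Nat.cast_pos.2 (Nat.pos_of_ne_zero this)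
  have hsup : ∀ b i, f b i ≤ ⨆ i, f b i := fun b i => le_ciSup (Set.finite_range _).bddAbove i
  have hinf : ∀ b i, ⨅ i, f b i ≤ f b i := fun b i => ciInf_le (Set.finite_range _).bddBelow i
  have hinfpos : ∀ b, 0 < ⨅ i, f b i := fun b => by
    obtain ⟨i, hi⟩ := exists_eq_ciInf_of_finite (f := f b)
    rw [← hi]
    exact hpos b i
  have hle : ∀ b, (⨆ i, f b i) / (⨅ i, f (!b) i) ≤ generatorRatio φ gen := by
    intro b
    cases b
    · exact le_max_left _ _
    · exact le_max_right _ _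
  have hlet : ∀ b i, f b i ≤ generatorRatio φ gen * f (!b) i := by
    intro b i
    refine le_trans ?_ (mul_le_mul_of_nonneg_right (hle b) (hpos _ i).le)
    rw [div_mul_eq_mul_div, le_div_iff₀ (hinfpos _)]
    exact mul_le_mul (hsup b i) (hinf _ i) (hinfpos _).le ((hpos b i).le.trans (hsup b i))
  refine ⟨?_, fun b c => ?_⟩
  -- The two lengths of one generator are positive and each is at most λ times the other, which
  -- excludes λ < 1.
  · obtain ⟨i⟩ := ‹Nonempty ι›
    by_contra! hlt
    have h2 := hlet false i
    have h3 := hlet true i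
    have h4 := hpos false i
    have h5 := hpos true i
    simp only [Bool.not_false, Bool.not_true] at h2 h3
    nlinarith
  · obtain ⟨z, rfl, hz⟩ := hgen c
    rw [← hz b, ← hz (!b)]
    clear hz
    induction z with
    | nil => simp [substLength]
    | cons p z ih =>
      have := hlet b p.1
      simp only [substLength, List.map_cons, List.sum_cons, Nat.cast_add, mul_add] at ih ⊢
      exact add_le_add this ih

variable {d : Transversal φ}

theorem exists_norm_add_norm_le [Finite ι] (hd : IsMinimal d)
    (hgen : Subgroup.closure (Set.range gen) = ⊤) :
    ∃ N, ∀ b, ∀ s ∈ d.set b, ∀ c, (φ b c).norm + s.norm ≤ (φ b c * s).norm + 2 * N := by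
  have h : ∀ b, ∃ N, ∀ s ∈ d.set b, ∀ c, (φ b c).norm + s.norm ≤ (φ b c * s).norm + 2 * N := by
    intro b
    obtain ⟨N, hN⟩ := ((finite_segments fun i => φ b (gen i)).image FreeGroup.norm).bddAbove
    refine ⟨N, fun s hs c => ?_⟩
    obtain ⟨z, rfl⟩ := exists_evalWord hgen c
    rw [map_evalWord]
    refine norm_add_norm_le (fun r hr => hN ⟨r, hr, rfl⟩) (fun z' => ?_) z
    rw [← map_evalWord]
    exact hd b s hs _
  choose N hN using h
  refine ⟨max (N false) (N true), fun b s hs c => (hN b s hs c).trans ?_⟩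
  cases b <;> gcongr <;> simp

theorem exists_isOffset [Finite ι] (hd : IsMinimal d)
    (hgen : Subgroup.closure (Set.range gen) = ⊤) : ∃ M : ℕ, IsOffset d M := by
  obtain ⟨N, hN⟩ := exists_norm_add_norm_le hd hgen
  exact ⟨2 * N, fun b s hs c => (Nat.le_add_right _ _).trans (hN b s hs c)⟩

theorem exists_linearTime [Finite ι] (hd : IsMinimal d)
    (hgen : Subgroup.closure (Set.range gen) = ⊤) :
    ∃ (L : ℕ) (P : ∀ b, CosetAlgorithm (fun i => φ b (gen i)) (d.set b)), LinearTime P L := by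
  obtain ⟨M, hM⟩ := exists_isOffset hd hgen
  choose K hK using fun b => exists_evalWord_length_le fun i => φ b (gen i)
  -- The offset bounds the subgroup part by |g| + M, undistortedness turns this into a word of
  -- length at most K(|g| + M), and minimality gives |s| ≤ |g|.
  have h : ∀ b g, ∃ z, ∃ s ∈ d.set b, evalWord (fun i => φ b (gen i)) z * s = g ∧
      z.length + s.norm ≤ ((K false + K true) * (M + 1) + 1) * (g.norm + 1) := by
    intro b g
    obtain ⟨⟨⟨_, c, rfl⟩, ⟨s, hs⟩⟩, hcs⟩ := (d.compl b).surjective g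
    obtain ⟨z, rfl⟩ := exists_evalWord hgen c
    obtain ⟨z', h, hl⟩ := hK b z
    simp only at hcs
    rw [← map_evalWord, ← map_evalWord] at h
    rw [← map_evalWord] at hl
    refine ⟨z', s, hs, by rw [← map_evalWord, h, hcs], ?_⟩
    have h1 := hM b s hs (evalWord gen z)
    have h2 := hd b s hs (evalWord gen z)
    rw [hcs] at h1 h2
    have h3 : K b ≤ K false + K true := by cases b <;> simp
    calc z'.length + s.norm ≤ (K false + K true) * (g.norm + M) + g.norm :=
          add_le_add (hl.trans (Nat.mul_le_mul h3 h1)) h2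
      _ ≤ (K false + K true) * ((M + 1) * (g.norm + 1)) + (g.norm + 1) := by
          gcongr
          · nlinarith [Nat.zero_le (M * g.norm)]
          · lia
      _ = _ := by ring
  choose word rep hmem hspec htime using h
  -- The time is taken to be the length of the output, the least value allowed.
  exact ⟨_, fun b => ⟨word b, rep b, fun g => (word b g).length + (rep b g).norm, hmem b, hspec b,
    fun _ => le_rfl⟩, htime⟩

end Constants

/-! ### The upper bound for the running time. -/

section UpperBound

variable {X : Bool → Type*} [∀ b, DecidableEq (X b)] {ι : Type*}
  {u : ∀ b, ι → FreeGroup (X b)} {S : ∀ b, Set (FreeGroup (X b))}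

/-- The lengths of c and of the tail are bounded jointly, because splitting `s * t` moves letters
from the tail into c. Each of the at most two splits adds at most 2N to the sum, whence 4N; the 1 in
`B` pays for the additive constants in the cost. The word for c is bounded by the time of the calls
that produced it, not by the length of its value. -/
theorem run_cons_bound (P : ∀ b, CosetAlgorithm (u b) (S b)) {L U N : ℕ} (hL : LinearTime P L)
    (hU : ∀ b i, (u b i).norm ≤ U)
    (hS : ∀ b, ∀ s ∈ S b, ∀ z, s.norm ≤ (evalWord (u b) z * s).norm)
    (hN : ∀ b, ∀ s ∈ S b, ∀ z,
      (evalWord (u b) z).norm + s.norm ≤ (evalWord (u b) z * s).norm + 2 * N)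
    (b : Bool) (g : FreeGroup (X b)) (rest : List (Syllable X)) (z : List (ι × Bool))
    (tail : List (Syllable X)) {B : ℕ}
    (hB : (evalWord (u b) z).norm + inputLength tail + g.norm + 4 * N + 1 ≤ B) :
    ∃ z' tail', (run P (⟨b, g⟩ :: rest) z tail).2 ≤
        (1 + U) * z.length + (2 + 2 * L) * B + (run P rest z' tail').2 ∧
      z'.length ≤ 2 * L * B ∧
      (evalWord (u b) z').norm + inputLength tail' ≤ B := by
  have split : ∀ y, (evalWord (u b) ((P b).word y)).norm + ((P b).rep y).norm ≤ y.norm + 2 * N ∧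
      ((P b).rep y).norm ≤ y.norm ∧ ((P b).word y).length ≤ (P b).time y ∧
      (P b).time y ≤ L * (y.norm + 1) := by
    intro y
    have h1 := hN b _ ((P b).rep_mem y) ((P b).word y)
    have h2 := hS b _ ((P b).rep_mem y) ((P b).word y)
    have h3 := (P b).output_le_time y
    rw [(P b).spec] at h1 h2
    exact ⟨h1, h2, by lia, hL b y⟩
  set h := g * evalWord (u b) z with hh
  have hnorm : h.norm ≤ g.norm + (evalWord (u b) z).norm := FreeGroup.norm_mul_le _ _
  have hsub := substLength_le (hU b) z
  obtain ⟨h1, h2, h3, h4⟩ := split h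
  have hLB : ∀ {x}, x + 1 ≤ B → L * (x + 1) ≤ L * B := fun hx => Nat.mul_le_mul_left _ hx
  have hUz : (1 + U) * z.length = z.length + U * z.length := by ring
  have hLB2 : (2 + 2 * L) * B = 2 * B + L * B + L * B := by ring
  have hLB3 : 2 * L * B = L * B + L * B := by ring
  rw [hUz, hLB2, hLB3]
  have key : 1 + z.length + substLength (u b) z + g.norm + (P b).time h ≤
      z.length + U * z.length + B + L * B := by
    have := hLB (x := h.norm) (by lia)
    lia
  have hone := hLB (x := h.norm) (by lia)
  by_cases hs : (P b).rep h = 1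
  · refine ⟨(P b).word h, tail, ?_, ?_, ?_⟩
    · simp only [run, ← hh, hs, if_true]
      lia
    · lia
    · lia
  · match tail with
    | [] =>
      refine ⟨(P b).word h, [⟨b, (P b).rep h⟩], ?_, ?_, ?_⟩
      · simp only [run, ← hh, hs, if_false]
        lia
      · lia
      · simp only [inputLength, List.map_nil, List.sum_nil, List.map_cons, List.sum_cons] at hB ⊢
        lia
    | ⟨b', t⟩ :: tail' =>
      simp only [inputLength, List.map_cons, List.sum_cons] at hB
      by_cases e : b' = b
      · subst e
        have hy : ((P b').rep h * t).norm ≤ ((P b').rep h).norm + t.norm :=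
          FreeGroup.norm_mul_le _ _
        obtain ⟨k1, k2, k3, k4⟩ := split ((P b').rep h * t)
        have := hLB (x := ((P b').rep h * t).norm) (by lia)
        have hmul := FreeGroup.norm_mul_le (evalWord (u b') ((P b').word h))
          (evalWord (u b') ((P b').word ((P b').rep h * t)))
        by_cases hs' : (P b').rep ((P b').rep h * t) = 1
        · refine ⟨(P b').word h ++ (P b').word ((P b').rep h * t), tail', ?_, ?_, ?_⟩
          · simp only [run, ← hh, hs, if_false, dif_pos, hs', if_true]
            lia
          · rw [List.length_append]
            lia
          · rw [evalWord_append, inputLength]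
            lia
        · refine ⟨(P b').word h ++ (P b').word ((P b').rep h * t),
            ⟨b', (P b').rep ((P b').rep h * t)⟩ :: tail', ?_, ?_, ?_⟩
          · simp only [run, ← hh, hs, if_false, dif_pos, hs']
            lia
          · rw [List.length_append]
            lia
          · rw [evalWord_append]
            simp only [inputLength, List.map_cons, List.sum_cons]
            lia
      · refine ⟨(P b).word h, ⟨b, (P b).rep h⟩ :: ⟨b', t⟩ :: tail', ?_, ?_, ?_⟩
        · simp only [run, ← hh, hs, if_false, e, dif_neg, not_false_eq_true]
          lia
        · lia
        · simp only [inputLength, List.map_cons, List.sum_cons]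
          lia

/-- In the constant, 2 + 2L pays for a round and (1 + U)·2L for reading, in the next round, the word
that this round produced. The bound `A` refers to the factor of the next syllable, so nothing is
required when none is left. -/
theorem run_le (P : ∀ b, CosetAlgorithm (u b) (S b)) {L U N : ℕ} (hL : LinearTime P L)
    (hU : ∀ b i, (u b i).norm ≤ U)
    (hS : ∀ b, ∀ s ∈ S b, ∀ z, s.norm ≤ (evalWord (u b) z * s).norm)
    (hN : ∀ b, ∀ s ∈ S b, ∀ z,
      (evalWord (u b) z).norm + s.norm ≤ (evalWord (u b) z * s).norm + 2 * N)
    {lam : ℝ} (h1 : 1 ≤ lam)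
    (hlam : ∀ b z, ((evalWord (u b) z).norm : ℝ) ≤ lam * (evalWord (u (!b)) z).norm)
    (l : List (Syllable X)) (hl : l.IsChain fun x y => x.1 ≠ y.1) (z : List (ι × Bool))
    (tail : List (Syllable X)) (A : ℝ) (hA0 : 0 ≤ A)
    (hA : ∀ x ∈ l.head?, ((evalWord (u x.1) z).norm : ℝ) + inputLength tail ≤ A) :
    ((run P l z tail).2 : ℝ) ≤ (1 + U) * z.length +
      (2 + 2 * L + (1 + U) * (2 * L)) * l.length * lam ^ l.length *
        (A + inputLength l + l.length * (4 * N + 1)) := by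
  induction l generalizing z tail A with
  | nil => simp only [run, Nat.cast_zero, List.length_nil]; positivity
  | cons x rest ih =>
    obtain ⟨b, g⟩ := x
    obtain ⟨z', tail', ht, hz', hN'⟩ := run_cons_bound P hL hU hS hN b g rest z tail le_rfl
    set B : ℕ := (evalWord (u b) z).norm + inputLength tail + g.norm + 4 * N + 1 with hB
    have hBA : (B : ℝ) ≤ A + g.norm + (4 * N + 1) := by
      have := hA ⟨b, g⟩ (by simp)
      simp only at this
      rw [hB]
      push_cast
      linarith
    -- The next syllable lies in the other factor, where c has grown by at most λ. The tail is not
    -- rewritten, but λ ≥ 1 lets it be included in λB.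
    have hih := ih hl.of_cons z' tail' (lam * B) (by positivity) (by
      intro x hx
      have hb : x.1 = !b := by
        cases rest with
        | nil => simp at hx
        | cons y rest =>
          obtain rfl : y = x := by simpa using hx
          have := (List.isChain_cons_cons.1 hl).1
          revert this
          cases b <;> cases y.1 <;> simp
      rw [hb]
      have e1 := hlam (!b) z'
      rw [Bool.not_not] at e1
      have e2 : ((evalWord (u b) z').norm : ℝ) + inputLength tail' ≤ B := by exact_mod_cast hN'
      have e3 : (inputLength tail' : ℝ) ≤ lam * inputLength tail' :=
        le_mul_of_one_le_left (by positivity) h1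
      nlinarith)
    have ht' : ((run P (⟨b, g⟩ :: rest) z tail).2 : ℝ) ≤
        (1 + U) * z.length + (2 + 2 * L) * B + (run P rest z' tail').2 := by exact_mod_cast ht
    have hz'' : (z'.length : ℝ) ≤ 2 * L * B := by exact_mod_cast hz'
    have hlen : (inputLength (⟨b, g⟩ :: rest) : ℝ) = g.norm + inputLength rest := by
      simp [inputLength]
    rw [hlen, List.length_cons]
    push_cast
    set k : ℝ := (rest.length : ℝ)
    set Q : ℝ := (inputLength rest : ℝ)
    set K : ℝ := 2 + 2 * L + (1 + U) * (2 * L) with hK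
    have hk : 0 ≤ k := by positivity
    have hQ : 0 ≤ Q := by positivity
    set D : ℝ := A + (g.norm + Q) + (k + 1) * (4 * N + 1) with hD
    have hn : (0 : ℝ) ≤ k * (4 * N + 1) := by positivity
    have hBD : (B : ℝ) + Q + k * (4 * N + 1) ≤ D := by rw [hD]; linarith
    have hD0 : 0 ≤ D := by positivity
    have hpow : 1 ≤ lam ^ (rest.length + 1) := one_le_pow₀ h1
    calc ((run P (⟨b, g⟩ :: rest) z tail).2 : ℝ)
        ≤ (1 + U) * z.length + (2 + 2 * L) * B + ((1 + U) * (2 * L * B) +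
            K * k * lam ^ rest.length * (lam * B + Q + k * (4 * N + 1))) := by
          refine ht'.trans (add_le_add le_rfl (hih.trans ?_))
          gcongr
      _ = (1 + U) * z.length + (K * B +
            K * k * lam ^ rest.length * (lam * B + Q + k * (4 * N + 1))) := by rw [hK]; ring
      _ ≤ (1 + U) * z.length + (K * (lam ^ (rest.length + 1) * D) +
            K * k * lam ^ rest.length * (lam * D)) := by
          gcongr
          · nlinarith
          · have e1 : Q ≤ lam * Q := le_mul_of_one_le_left hQ h1
            have e2 := le_mul_of_one_le_left hn h1
            nlinarith
      _ = _ := by ring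

theorem length_le_inputLength {w : List (Syllable X)} (hw : ∀ x ∈ w, x.2 ≠ 1) :
    w.length ≤ inputLength w := by
  induction w with
  | nil => simp
  | cons x w ih =>
    have h1 := ih fun y hy => hw y (List.mem_cons_of_mem _ hy)
    have h2 : x.2.norm ≠ 0 := by
      rw [Ne, FreeGroup.norm_eq_zero]
      exact hw x List.mem_cons_self
    simp only [inputLength, List.length_cons, List.map_cons, List.sum_cons] at h1 ⊢
    lia

theorem time_le (P : ∀ b, CosetAlgorithm (u b) (S b)) {L U N : ℕ} (hL : LinearTime P L)
    (hU : ∀ b i, (u b i).norm ≤ U)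
    (hS : ∀ b, ∀ s ∈ S b, ∀ z, s.norm ≤ (evalWord (u b) z * s).norm)
    (hN : ∀ b, ∀ s ∈ S b, ∀ z,
      (evalWord (u b) z).norm + s.norm ≤ (evalWord (u b) z * s).norm + 2 * N)
    {lam : ℝ} (h1 : 1 ≤ lam)
    (hlam : ∀ b z, ((evalWord (u b) z).norm : ℝ) ≤ lam * (evalWord (u (!b)) z).norm)
    {w : List (Syllable X)} (hw : IsInput w) (M : ℕ) :
    (time P w : ℝ) ≤ w.length * ((2 + 2 * L + (1 + U) * (2 * L)) * (4 * N + 2)) *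
      inputLength w * lam ^ w.length * (inputLength w + M) := by
  have hchain : w.reverse.IsChain fun x y => x.1 ≠ y.1 :=
    List.isChain_reverse.2 (hw.1.imp fun _ _ h => h.symm)
  have h := run_le P hL hU hS hN h1 hlam w.reverse hchain [] [] 0 le_rfl (by simp [inputLength])
  have hrev : inputLength w.reverse = inputLength w := by
    simp [inputLength, List.sum_reverse]
  rw [List.length_reverse, hrev] at h
  have hk : (w.length : ℝ) ≤ inputLength w := by exact_mod_cast length_le_inputLength hw.2
  have hsq : (inputLength w : ℝ) ≤ inputLength w * inputLength w := by
    exact_mod_cast Nat.le_mul_self _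
  refine h.trans ?_
  calc _ = (2 + 2 * L + (1 + U) * (2 * L)) * w.length * lam ^ w.length *
        (inputLength w + w.length * (4 * N + 1)) := by simp
    _ ≤ (2 + 2 * L + (1 + U) * (2 * L)) * w.length * lam ^ w.length *
        -- Since k ≤ |w|, the last factor is at most (4N + 2)|w|; the remaining factor |w| + M is
        -- slack, by |w| ≤ |w|².
        ((4 * N + 2) * (inputLength w * (inputLength w + M))) := by
        gcongr
        have : (0 : ℝ) ≤ N := by positivity
        have : (0 : ℝ) ≤ inputLength w * M := by positivity
        nlinarith
    _ = _ := by ring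

end UpperBound

/-- The factors k, n and n + M each contribute a power of 2, whence the 8; n ≥ 1 gives L ≤ L^n. -/
theorem polynomial_mul_pow_le_pow {k n : ℕ} (hk : k ≤ n) (hkn : n = 0 → k = 0) (M : ℕ)
    {L lam : ℝ} (hL : 1 ≤ L) (hlam : 1 ≤ lam) :
    k * L * n * lam ^ k * (n + M) ≤ (8 * L * lam * (1 + M)) ^ n := by
  rcases Nat.eq_zero_or_pos n with rfl | hn
  · simp
  have h2 : (n : ℝ) ≤ 2 ^ n := by exact_mod_cast Nat.lt_two_pow_self.le
  have hk2 : (k : ℝ) ≤ 2 ^ n := le_trans (by exact_mod_cast hk) h2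
  have hM : (n : ℝ) + M ≤ 2 ^ n * (1 + M) ^ n := by
    have h1 : (1 : ℝ) ≤ n := by exact_mod_cast hn
    have hM0 : (0 : ℝ) ≤ M := by positivity
    calc (n : ℝ) + M ≤ n * (1 + M) := by nlinarith
      _ ≤ 2 ^ n * (1 + M) ^ n := by
        gcongr
        exact le_self_pow₀ (by linarith) hn.ne'
  calc (k : ℝ) * L * n * lam ^ k * (n + M)
      ≤ 2 ^ n * L ^ n * 2 ^ n * lam ^ n * (2 ^ n * (1 + M) ^ n) := by
        gcongr
        exact le_self_pow₀ hL hn.ne'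
    _ = _ := by
        rw [show (8 : ℝ) = 2 * 2 * 2 by norm_num]
        simp only [mul_pow]
        ring

/-! ### Minimal transversals from geodesic spanning trees of coset graphs. -/

section CosetGraph

open FreeGroup

variable {α : Type*} [DecidableEq α]

theorem mul_mk_singleton_cases (s : FreeGroup α) (l : α × Bool) :
    (s.toWord = (s * mk [l]).toWord ++ [(l.1, !l.2)]) ∨
      (s * mk [l]).toWord = s.toWord ++ [l] ∧ IsReduced (s.toWord ++ [l]) := by
  obtain ⟨p, q, r, hs, hl, hred⟩ := exists_cancellation [l] (by simp) _ s.isReduced_toWord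
  cases q using List.reverseRecOn with
  | nil =>
    obtain rfl : r = [l] := by simpa using hl.symm
    rw [List.append_nil] at hs
    rw [← hs] at hred
    refine Or.inr ⟨?_, hred⟩
    rw [toWord_mul, toWord_mk, reduce_singleton, hred.reduce_eq]
  | append_singleton q a =>
    left
    have hlen := congrArg List.length hl
    simp only [invRev_append, List.append_assoc, List.length_append, invRev_length,
      List.length_singleton] at hlen
    obtain rfl : q = [] := List.length_eq_zero_iff.1 (by lia)
    obtain rfl : r = [] := List.length_eq_zero_iff.1 (by lia)
    obtain rfl : l = (a.1, !a.2) := by simpa [invRev] using hl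
    rw [List.append_nil] at hred
    rw [List.nil_append] at hs
    have : s * mk [(a.1, !a.2)] = mk p := by
      rw [← mk_toWord (x := s), hs, mul_mk, List.append_assoc]
      refine Quot.sound ?_
      simpa using Red.Step.not (L₁ := p) (L₂ := []) (x := a.1) (b := a.2)
    rw [this, toWord_mk, hred.reduce_eq, hs]
    simp

/-- The coset graph of a subgroup of a free group, with a spanning tree. The vertices are the
elements whose reduced words stay in the tree. The edge that ends an exceptional word `p` is outside
the tree and leads to the vertex `t` for which `exit p = some t`. -/
structure CosetGraph (H : Subgroup (FreeGroup α)) where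
  ofExits ::
  /-- the end point of the edge outside the tree, for the exceptional words -/
  exit : List (α × Bool) → Option (FreeGroup α)
  vertex_of_exit : ∀ p t, exit p = some t → ∀ q, q <+: t.toWord → exit q = none
  isReduced_of_exit : ∀ p t, exit p = some t → IsReduced p
  mem_of_exit : ∀ p t, exit p = some t → mk p * t⁻¹ ∈ H
  norm_le_of_exit : ∀ p t, exit p = some t → t.norm ≤ p.length
  exit_symm : ∀ p l t, exit (p ++ [l]) = some t → exit (t.toWord ++ [(l.1, !l.2)]) = some (mk p)

namespace CosetGraph

variable {H : Subgroup (FreeGroup α)} (Γ : CosetGraph H)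

/-- The vertices of the coset graph. -/
def vertices : Set (FreeGroup α) := {s | ∀ q, q <+: s.toWord → Γ.exit q = none}

/-- Follow the edge with the given label. -/
def step (s : FreeGroup α) (l : α × Bool) : FreeGroup α :=
  (Γ.exit (s.toWord ++ [l])).getD (s * mk [l])

variable {Γ}

theorem step_mem {s : FreeGroup α} (hs : s ∈ Γ.vertices) (l : α × Bool) :
    Γ.step s l ∈ Γ.vertices := by
  unfold step
  cases h : Γ.exit (s.toWord ++ [l]) with
  | some t => exact Γ.vertex_of_exit _ _ h
  | none =>
    intro q hq
    rw [Option.getD_none] at hq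
    rcases mul_mk_singleton_cases s l with h' | ⟨h', -⟩
    · exact hs q (h' ▸ hq.trans (List.prefix_append _ _))
    · rw [h', List.prefix_concat_iff] at hq
      rcases hq with rfl | hq
      · exact h
      · exact hs q hq

/-- An edge traversed backwards returns to its start: `exit_symm` covers edges outside the tree.
Inside the tree no exit can intervene, since exceptional words are reduced. -/
theorem step_step {s : FreeGroup α} (hs : s ∈ Γ.vertices) (a : α) (b : Bool) :
    Γ.step (Γ.step s (a, b)) (a, !b) = s := by
  cases h : Γ.exit (s.toWord ++ [(a, b)]) with
  | some t => simp [step, h, Γ.exit_symm _ _ _ h, mk_toWord]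
  | none =>
    have hcancel : s * mk [(a, b)] * mk [(a, !b)] = s := by
      have : (mk [(a, b)] : FreeGroup α)⁻¹ = mk [(a, !b)] := by rw [inv_mk]; rfl
      rw [← this, mul_inv_cancel_right]
    have h2 : Γ.exit ((s * mk [(a, b)]).toWord ++ [(a, !b)]) = none := by
      rcases mul_mk_singleton_cases s (a, b) with h' | ⟨h', -⟩
      · rw [← h']
        exact hs _ List.prefix_rfl
      · by_contra hne
        obtain ⟨t, ht⟩ := Option.ne_none_iff_exists'.1 hne
        have := Γ.isReduced_of_exit _ _ ht
        rw [h', List.append_assoc] at this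
        have := List.IsChain.right_of_append this
        simp at this
    simp [step, h, h2, hcancel]

theorem mul_step_inv_mem (s : FreeGroup α) (l : α × Bool) :
    s * mk [l] * (Γ.step s l)⁻¹ ∈ H := by
  unfold step
  cases h : Γ.exit (s.toWord ++ [l]) with
  | some t => simpa only [← mul_mk, mk_toWord, Option.getD_some] using Γ.mem_of_exit _ _ h
  | none => rw [Option.getD_none, mul_inv_cancel]; exact H.one_mem

theorem norm_step_le (s : FreeGroup α) (l : α × Bool) : (Γ.step s l).norm ≤ s.norm + 1 := by
  unfold step
  cases h : Γ.exit (s.toWord ++ [l]) with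
  | some t => simpa [FreeGroup.norm] using Γ.norm_le_of_exit _ _ h
  | none => exact (FreeGroup.norm_mul_le _ _).trans (Nat.add_le_add_left norm_mk_le _)

variable (Γ) in
/-- Follow a path of edges with the given labels. -/
def act (s : FreeGroup α) (L : List (α × Bool)) : FreeGroup α := L.foldl Γ.step s

theorem act_append (s : FreeGroup α) (L L' : List (α × Bool)) :
    Γ.act s (L ++ L') = Γ.act (Γ.act s L) L' := List.foldl_append

theorem act_mem {s : FreeGroup α} (hs : s ∈ Γ.vertices) (L : List (α × Bool)) :
    Γ.act s L ∈ Γ.vertices := by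
  induction L generalizing s with
  | nil => exact hs
  | cons l L ih => exact ih (step_mem hs l)

/-- The end of a path depends only on the group element its label represents, so the free group acts
on the vertices. -/
theorem act_eq_of_red {s : FreeGroup α} (hs : s ∈ Γ.vertices) {L L' : List (α × Bool)}
    (h : Red L L') : Γ.act s L = Γ.act s L' := by
  induction h with
  | refl => rfl
  | tail _ hstep ih =>
    rw [ih]
    obtain @⟨A, B, x, b⟩ := hstep
    rw [act_append, act_append]
    change Γ.act (Γ.step (Γ.step _ _) _) B = _
    rw [step_step (act_mem hs A)]

theorem mul_act_inv_mem (s : FreeGroup α) (L : List (α × Bool)) :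
    s * mk L * (Γ.act s L)⁻¹ ∈ H := by
  induction L generalizing s with
  | nil =>
    change s * 1 * s⁻¹ ∈ H
    simp
  | cons l L ih =>
    have h := H.mul_mem (mul_step_inv_mem (Γ := Γ) s l) (ih (Γ.step s l))
    have e : mk (l :: L) = mk [l] * mk L := by rw [mul_mk]; rfl
    have : s * mk [l] * (Γ.step s l)⁻¹ * (Γ.step s l * mk L * (Γ.act (Γ.step s l) L)⁻¹) =
        s * mk (l :: L) * (Γ.act s (l :: L))⁻¹ := by
      rw [e]
      change _ = s * (mk [l] * mk L) * (Γ.act (Γ.step s l) L)⁻¹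
      group
    rwa [this] at h

/-- This makes the tree geodesic: a path from the base point has at least as many edges as its end
point has letters. -/
theorem norm_act_le (s : FreeGroup α) (L : List (α × Bool)) :
    (Γ.act s L).norm ≤ s.norm + L.length := by
  induction L generalizing s with
  | nil => exact le_rfl
  | cons l L ih =>
    refine (ih _).trans ?_
    have := norm_step_le (Γ := Γ) s l
    simp only [List.length_cons]
    lia

theorem act_one_toWord {s : FreeGroup α} (hs : s ∈ Γ.vertices) : Γ.act 1 s.toWord = s := by
  have : ∀ p, p <+: s.toWord → Γ.act 1 p = mk p := by
    intro p hp
    induction p using List.reverseRecOn with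
    | nil => rfl
    | append_singleton p l ih =>
      have hp' : p <+: s.toWord := (List.prefix_append _ _).trans hp
      have hred : IsReduced p := s.isReduced_toWord.infix hp'.isInfix
      rw [act_append, ih hp']
      change Γ.step _ l = _
      rw [step, toWord_mk, hred.reduce_eq, hs _ hp, Option.getD_none, mul_mk]
  rw [this _ List.prefix_rfl, mk_toWord]

variable (Γ) in
/-- The end point of the path with the given label that starts at the base point. -/
def rep (g : FreeGroup α) : FreeGroup α := Γ.act 1 g.toWord

theorem one_mem_vertices (h : Γ.exit [] = none) : 1 ∈ Γ.vertices := by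
  intro q hq
  rw [toWord_one, List.prefix_nil] at hq
  rw [hq, h]

theorem rep_mul (h : Γ.exit [] = none) (g g' : FreeGroup α) :
    Γ.rep (g * g') = Γ.act (Γ.rep g) g'.toWord := by
  rw [rep, toWord_mul, ← act_eq_of_red (one_mem_vertices h) reduce.red, act_append, rep]

/-- The elements that fix the base point form a subgroup, so only generators of `H` have to be
tested. -/
theorem rep_eq_one (h : Γ.exit [] = none) {A : Set (FreeGroup α)} (hA : H = Subgroup.closure A)
    (hrep : ∀ a ∈ A, Γ.rep a = 1) {g : FreeGroup α} (hg : g ∈ H) : Γ.rep g = 1 := by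
  subst hA
  induction hg using Subgroup.closure_induction with
  | mem a ha => exact hrep a ha
  | one => exact act_one_toWord (one_mem_vertices h)
  | mul a b _ _ iha ihb => rw [rep_mul h, iha]; exact ihb
  | inv a _ ih =>
    have := rep_mul h a a⁻¹
    rw [ih, mul_inv_cancel] at this
    rw [rep, ← this]
    exact act_one_toWord (one_mem_vertices h)

theorem rep_mul_of_mem (h : Γ.exit [] = none) {A : Set (FreeGroup α)}
    (hA : H = Subgroup.closure A) (hrep : ∀ a ∈ A, Γ.rep a = 1) {g s : FreeGroup α} (hg : g ∈ H)
    (hs : s ∈ Γ.vertices) : Γ.rep (g * s) = s := by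
  rw [rep_mul h, rep_eq_one h hA hrep hg, act_one_toWord hs]

theorem norm_le_norm_mul (h : Γ.exit [] = none) {A : Set (FreeGroup α)}
    (hA : H = Subgroup.closure A) (hrep : ∀ a ∈ A, Γ.rep a = 1) {g s : FreeGroup α} (hg : g ∈ H)
    (hs : s ∈ Γ.vertices) : s.norm ≤ (g * s).norm := by
  have := norm_act_le (Γ := Γ) 1 (g * s).toWord
  rw [FreeGroup.norm_one, zero_add] at this
  rwa [← rep, rep_mul_of_mem h hA hrep hg hs] at this

/-- The representative is recovered from the product as the end point of its path; conversely g·(rep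
g)⁻¹ always lies in `H`. -/
theorem isComplement (h : Γ.exit [] = none) {A : Set (FreeGroup α)}
    (hA : H = Subgroup.closure A) (hrep : ∀ a ∈ A, Γ.rep a = 1) :
    Subgroup.IsComplement (H : Set (FreeGroup α)) Γ.vertices := by
  constructor
  · rintro ⟨⟨a, ha⟩, ⟨s, hs⟩⟩ ⟨⟨a', ha'⟩, ⟨s', hs'⟩⟩ (e : a * s = a' * s')
    have h1 := rep_mul_of_mem h hA hrep ha hs
    rw [e, rep_mul_of_mem h hA hrep ha' hs'] at h1
    subst h1
    obtain rfl := mul_right_cancel e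
    rfl
  · intro g
    have h1 := mul_act_inv_mem (Γ := Γ) 1 g.toWord
    rw [one_mul, mk_toWord] at h1
    exact ⟨⟨⟨_, h1⟩, ⟨_, act_mem (one_mem_vertices h) g.toWord⟩⟩, inv_mul_cancel_right _ _⟩

end CosetGraph

end CosetGraph

/-! ### Substitutions without cancellation. -/

section NoCancellation

variable {ι X : Type*} [DecidableEq X]

/-- As no block is empty, letters from different blocks are adjacent only if the blocks are, so
pairs suffice. -/
theorem isReduced_expand {u : ι → FreeGroup X} (h1 : ∀ p, letterValue u p ≠ 1)
    (h : ∀ p q : ι × Bool, (p.1 = q.1 → p.2 = q.2) →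
      FreeGroup.IsReduced ((letterValue u p).toWord ++ (letterValue u q).toWord))
    {z : List (ι × Bool)} (hz : FreeGroup.IsReduced z) : FreeGroup.IsReduced (expand u z) := by
  induction z with
  | nil => simp [expand]
  | cons p z ih =>
    have ih := ih hz.of_cons
    rw [expand, List.flatMap_cons]
    cases z with
    | nil => simpa using FreeGroup.isReduced_toWord
    | cons q z =>
      have hpq := h p q (List.isChain_cons_cons.1 hz).1
      rw [FreeGroup.IsReduced, List.isChain_append] at hpq ⊢
      refine ⟨hpq.1, ih, ?_⟩
      have hq : (letterValue u q).toWord ≠ [] := by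
        rw [Ne, FreeGroup.toWord_eq_nil_iff]
        exact h1 q
      rw [List.flatMap_cons, List.head?_append_of_ne_nil _ hq]
      exact hpq.2.2

theorem norm_lift_eq_substLength {u : ι → FreeGroup X} [DecidableEq ι]
    (h1 : ∀ p, letterValue u p ≠ 1)
    (h : ∀ p q : ι × Bool, (p.1 = q.1 → p.2 = q.2) →
      FreeGroup.IsReduced ((letterValue u p).toWord ++ (letterValue u q).toWord))
    (c : FreeGroup ι) : (FreeGroup.lift u c).norm = substLength u c.toWord := by
  have he : FreeGroup.lift u c = FreeGroup.mk (expand u c.toWord) := by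
    rw [mk_expand, evalWord, FreeGroup.mk_toWord]
  rw [he, FreeGroup.norm, FreeGroup.toWord_mk,
    (isReduced_expand h1 h c.isReduced_toWord).reduce_eq, expand, List.length_flatMap, substLength]
  congr 1
  exact List.map_congr_left fun p _ => norm_letterValue u p

theorem lift_injective_of_noCancellation {u : ι → FreeGroup X}
    (h1 : ∀ p, letterValue u p ≠ 1)
    (h : ∀ p q : ι × Bool, (p.1 = q.1 → p.2 = q.2) →
      FreeGroup.IsReduced ((letterValue u p).toWord ++ (letterValue u q).toWord)) :
    Function.Injective (FreeGroup.lift u) := by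
  classical
  refine (injective_iff_map_eq_one _).2 fun c hc => ?_
  have hn := norm_lift_eq_substLength h1 h c
  rw [hc, FreeGroup.norm_one] at hn
  rw [← FreeGroup.toWord_eq_nil_iff]
  cases hw : c.toWord with
  | nil => rfl
  | cons p z =>
    rw [hw, substLength, List.map_cons, List.sum_cons, ← norm_letterValue] at hn
    have : (letterValue u p).norm = 0 := by lia
    exact (h1 p (FreeGroup.norm_eq_zero.1 this)).elim

end NoCancellation

/-! ### Recursiveness of sets given by forbidden prefixes. -/

section Recursive

/-- Free reduction is a right fold that prepends a letter or cancels it against the head. It is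
needed because `IsRecursive` takes unreduced words as input. -/
theorem primrec_reduce {α : Type*} [Primcodable α] [DecidableEq α] :
    Primrec (FreeGroup.reduce : List (α × Bool) → List (α × Bool)) := by
  have hc : PrimrecPred fun x : ((List (α × Bool) × (α × Bool) × List (α × Bool)) ×
      (α × Bool) × List (α × Bool)) => x.1.2.1.1 = x.2.1.1 ∧ x.1.2.1.2 = !x.2.1.2 := by
    refine PrimrecPred.and ?_ ?_
    · exact Primrec.eq.comp
        (Primrec.fst.comp (Primrec.fst.comp (Primrec.snd.comp Primrec.fst)))
        (Primrec.fst.comp (Primrec.fst.comp Primrec.snd))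
    · exact Primrec.eq.comp
        (Primrec.snd.comp (Primrec.fst.comp (Primrec.snd.comp Primrec.fst)))
        (Primrec.not.comp (Primrec.snd.comp (Primrec.fst.comp Primrec.snd)))
  have hstep : Primrec₂ fun (_ : List (α × Bool)) (x : (α × Bool) × List (α × Bool)) =>
      List.casesOn (motive := fun _ => List (α × Bool)) x.2 [x.1] fun hd tl =>
        if x.1.1 = hd.1 ∧ x.1.2 = !hd.2 then tl else x.1 :: hd :: tl := by
    refine Primrec.list_casesOn (α := List (α × Bool) × (α × Bool) × List (α × Bool))
      (f := fun x => x.2.2) (g := fun x => [x.2.1])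
      (h := fun x y => if x.2.1.1 = y.1.1 ∧ x.2.1.2 = !y.1.2 then y.2 else x.2.1 :: y.1 :: y.2)
      (Primrec.snd.comp Primrec.snd) ?_ ?_
    · exact Primrec.list_cons.comp (α := List (α × Bool) × (α × Bool) × List (α × Bool))
        (Primrec.fst.comp Primrec.snd) (Primrec.const [])
    · exact Primrec.ite (σ := List (α × Bool)) hc (Primrec.snd.comp Primrec.snd)
        (Primrec.list_cons.comp (Primrec.fst.comp (Primrec.snd.comp Primrec.fst))
          (Primrec.list_cons.comp (Primrec.fst.comp Primrec.snd) (Primrec.snd.comp Primrec.snd)))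
  refine (Primrec.list_foldr Primrec.id (Primrec.const []) hstep).of_eq fun L => ?_
  induction L with
  | nil => rfl
  | cons a L ih =>
    rw [FreeGroup.reduce.cons, ← ih]
    simp only [id, List.foldr_cons]

theorem primrecPred_prefix {α : Type*} [Primcodable α] (p : List α) :
    PrimrecPred fun w : List α => p <+: w := by
  classical
  have : ∀ w : List α, (w.take p.length = p) ↔ p <+: w := fun w => by
    rw [List.prefix_iff_eq_take, eq_comm]
  refine PrimrecPred.of_eq ?_ this
  exact Primrec.eq.comp (Primrec.list_take.comp (Primrec.const _) Primrec.id) (Primrec.const p)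

/-- A set of elements given by finitely many forbidden prefixes is recursive. -/
theorem isRecursive_of_forbidden_prefixes {n : ℕ} (F : List (List (Fin n × Bool))) :
    IsRecursive {s : FreeGroup (Fin n) | ∀ p ∈ F, ¬ p <+: s.toWord} := by
  have h : PrimrecPred fun w : List (Fin n × Bool) => ∀ p ∈ F, ¬ p <+: w := by
    induction F with
    | nil =>
      refine PrimrecPred.of_eq (p := fun w : List (Fin n × Bool) => w = w) ?_ (by simp)
      exact Primrec.eq.comp Primrec.id Primrec.id
    | cons p F ih =>
      refine ((primrecPred_prefix p).not.and ih).of_eq fun w => ?_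
      simp
  obtain ⟨_, h'⟩ := PrimrecPred.comp h primrec_reduce
  exact ⟨_, h'.to_comp⟩

end Recursive

/-! ### The example: the subgroup generated by xy and yxyx. -/

section Example

open FreeGroup

/-- The word `x y` in the free group on `x` and `y`. -/
def shortGen : FreeGroup (Fin 2) := mk [(0, true), (1, true)]

/-- The word `y x y x` in the free group on `x` and `y`. -/
def longGen : FreeGroup (Fin 2) := mk [(1, true), (0, true), (1, true), (0, true)]

/-- The images of the two basis elements of the amalgamated subgroup in the two factors. -/
def ratioTwoGen (b : Bool) (i : Fin 2) : FreeGroup (Fin 2) :=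
  if (i == 0) = b then longGen else shortGen

/-- The index of the basis element whose image in the given factor is the short word. -/
def shortIndex (b : Bool) : Fin 2 := if b then 1 else 0

/-- The two embeddings of the free group of rank two. -/
def ratioTwoHom (b : Bool) : FreeGroup (Fin 2) →* FreeGroup (Fin 2) := lift (ratioTwoGen b)

theorem ratioTwoGen_shortIndex (b : Bool) : ratioTwoGen b (shortIndex b) = shortGen := by
  cases b <;> rfl

theorem ratioTwoGen_not_shortIndex (b : Bool) : ratioTwoGen (!b) (shortIndex b) = longGen := by
  cases b <;> rfl

theorem letterValue_ratioTwoGen_ne_one (b : Bool) (p : Fin 2 × Bool) :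
    letterValue (ratioTwoGen b) p ≠ 1 := by
  revert b p
  decide

theorem isReduced_letterValue_ratioTwoGen (b : Bool) (p q : Fin 2 × Bool)
    (h : p.1 = q.1 → p.2 = q.2) : IsReduced
      ((letterValue (ratioTwoGen b) p).toWord ++ (letterValue (ratioTwoGen b) q).toWord) := by
  rw [isReduced_iff_reduce_eq]
  revert b p q
  decide

theorem norm_ratioTwoHom (b : Bool) (c : FreeGroup (Fin 2)) :
    (ratioTwoHom b c).norm = substLength (ratioTwoGen b) c.toWord :=
  norm_lift_eq_substLength (letterValue_ratioTwoGen_ne_one b)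
    (isReduced_letterValue_ratioTwoGen b) c

theorem ratioTwoHom_injective (b : Bool) : Function.Injective (ratioTwoHom b) :=
  lift_injective_of_noCancellation (letterValue_ratioTwoGen_ne_one b)
    (isReduced_letterValue_ratioTwoGen b)

theorem isRewritingFactor_ratioTwoHom :
    IsRewritingFactor (X := fun _ => Fin 2) ratioTwoHom 2 := by
  refine ⟨one_le_two, fun b c => ?_⟩
  rw [norm_ratioTwoHom, norm_ratioTwoHom]
  have hle : ∀ i, (ratioTwoGen b i).norm ≤ 2 * (ratioTwoGen (!b) i).norm := by
    revert b
    decide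
  have : ∀ z : List (Fin 2 × Bool),
      substLength (ratioTwoGen b) z ≤ 2 * substLength (ratioTwoGen (!b)) z := by
    intro z
    induction z with
    | nil => simp [substLength]
    | cons p z ih =>
      have := hle p.1
      simp only [substLength, List.map_cons, List.sum_cons] at ih ⊢
      lia
  exact_mod_cast this _

/-- The exceptional words in the coset graph of the subgroup generated by `x y` and `y x y x`. -/
def exceptionalWords : List (List (Fin 2 × Bool)) :=
  [[(1, false)], [(0, true), (1, true)], [(1, true), (0, true), (1, true)], [(0, false), (1, false)]]

/-- The end points of the edges outside the spanning tree. -/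
def ratioTwoExit (p : List (Fin 2 × Bool)) : Option (FreeGroup (Fin 2)) :=
  if p = [(1, false)] then some (mk [(0, true)])
  else if p = [(0, true), (1, true)] then some 1
  else if p = [(1, true), (0, true), (1, true)] then some (mk [(0, false)])
  else if p = [(0, false), (1, false)] then some (mk [(1, true), (0, true)])
  else none

theorem ratioTwoExit_eq_none_iff (p : List (Fin 2 × Bool)) :
    ratioTwoExit p = none ↔ p ∉ exceptionalWords := by
  unfold ratioTwoExit exceptionalWords
  split_ifs <;> simp_all

theorem ratioTwoExit_cases {P : List (Fin 2 × Bool) → FreeGroup (Fin 2) → Prop}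
    (h₁ : P [(1, false)] (mk [(0, true)])) (h₂ : P [(0, true), (1, true)] 1)
    (h₃ : P [(1, true), (0, true), (1, true)] (mk [(0, false)]))
    (h₄ : P [(0, false), (1, false)] (mk [(1, true), (0, true)])) (p : List (Fin 2 × Bool))
    (t : FreeGroup (Fin 2)) (h : ratioTwoExit p = some t) : P p t := by
  unfold ratioTwoExit at h
  split_ifs at h <;> simp only [Option.some.injEq] at h <;> subst_vars <;> assumption

theorem forall_prefix_ratioTwoExit_iff (w : List (Fin 2 × Bool)) :
    (∀ q, q <+: w → ratioTwoExit q = none) ↔ ∀ p ∈ exceptionalWords, ¬ p <+: w := by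
  simp only [ratioTwoExit_eq_none_iff]
  exact ⟨fun h p hp hw => h p hw hp, fun h q hw hq => h q hq hw⟩

/-- The coset graph of the subgroup generated by `x y` and `y x y x`. -/
def ratioTwoGraph (b : Bool) : CosetGraph (ratioTwoHom b).range where
  exit := ratioTwoExit
  vertex_of_exit p t h := by
    rw [forall_prefix_ratioTwoExit_iff]
    revert p t
    apply ratioTwoExit_cases <;> decide
  isReduced_of_exit p t h := by
    rw [isReduced_iff_reduce_eq]
    revert p t
    apply ratioTwoExit_cases <;> decide
  mem_of_exit := by
    have hs : shortGen ∈ (ratioTwoHom b).range :=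
      ⟨of (shortIndex b), by rw [ratioTwoHom, lift_apply_of, ratioTwoGen_shortIndex]⟩
    have hl : longGen ∈ (ratioTwoHom b).range := by
      refine ⟨of (shortIndex !b), ?_⟩
      have := ratioTwoGen_not_shortIndex (!b)
      rw [Bool.not_not] at this
      rw [ratioTwoHom, lift_apply_of, this]
    apply ratioTwoExit_cases
    · exact inv_mem hs
    · exact hs
    · exact hl
    · exact inv_mem hl
  norm_le_of_exit := by
    apply ratioTwoExit_cases <;> decide
  exit_symm p l t h := by
    -- With p and l read off as `dropLast` and last letter, the symmetry becomes a statement about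
    -- four concrete words, decidable by evaluation.
    have := ratioTwoExit_cases (P := fun p t => ∀ l ∈ p.getLast?,
      ratioTwoExit (t.toWord ++ [(l.1, !l.2)]) = some (mk p.dropLast))
      (by decide) (by decide) (by decide) (by decide) _ _ h l (by simp)
    rwa [List.dropLast_concat] at this

theorem ratioTwoGraph_exit_nil (b : Bool) : (ratioTwoGraph b).exit [] = none := rfl

theorem rep_ratioTwoGen (b : Bool) :
    ∀ a ∈ Set.range (ratioTwoGen b), (ratioTwoGraph b).rep a = 1 := by
  rintro _ ⟨i, rfl⟩
  revert b i
  decide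

theorem range_ratioTwoHom (b : Bool) :
    (ratioTwoHom b).range = Subgroup.closure (Set.range (ratioTwoGen b)) :=
  range_lift_eq_closure

theorem vertices_ratioTwoGraph (b : Bool) :
    (ratioTwoGraph b).vertices = {s | ∀ p ∈ exceptionalWords, ¬ p <+: s.toWord} := by
  ext s
  exact forall_prefix_ratioTwoExit_iff s.toWord

/-- The transversals given by the spanning trees of the coset graphs. -/
def ratioTwoTransversal : Transversal (G := fun _ : Bool => FreeGroup (Fin 2)) ratioTwoHom where
  injective := ratioTwoHom_injective
  set b := (ratioTwoGraph b).vertices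
  one_mem b := CosetGraph.one_mem_vertices (ratioTwoGraph_exit_nil b)
  compl b := CosetGraph.isComplement (ratioTwoGraph_exit_nil b) (range_ratioTwoHom b)
    (rep_ratioTwoGen b)

theorem isMinimal_ratioTwoTransversal : IsMinimal (X := fun _ => Fin 2) ratioTwoTransversal :=
  fun b _ hs c => CosetGraph.norm_le_norm_mul (ratioTwoGraph_exit_nil b) (range_ratioTwoHom b)
    (rep_ratioTwoGen b) ⟨c, rfl⟩ hs

theorem isRecursive_ratioTwoTransversal (b : Bool) : IsRecursive (ratioTwoTransversal.set b) := by
  have : ratioTwoTransversal.set b = {s | ∀ p ∈ exceptionalWords, ¬ p <+: s.toWord} :=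
    vertices_ratioTwoGraph b
  rw [this]
  exact isRecursive_of_forbidden_prefixes _

theorem of_zero_mem_ratioTwoTransversal (b : Bool) : of 0 ∈ ratioTwoTransversal.set b := by
  have : of 0 ∈ (ratioTwoGraph b).vertices := by
    rw [vertices_ratioTwoGraph, Set.mem_ofPred_eq]
    decide
  exact this

theorem norm_shortGen_pow (N : ℕ) : (shortGen ^ N).norm = 2 * N := by
  have h : shortGen ^ N = ratioTwoHom false (of 0 ^ N) := by
    rw [map_pow, ratioTwoHom, lift_apply_of]
    rfl
  have h2 : (ratioTwoGen false 0).norm = 2 := by decide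
  rw [h, norm_ratioTwoHom, toWord_of_pow, substLength, List.map_replicate, List.sum_replicate, h2,
    smul_eq_mul, mul_comm]

/-- The source of the growth: moving x past the long word turns it into two short ones. -/
theorem of_zero_mul_longGen_pow (N : ℕ) : of 0 * longGen ^ N = shortGen ^ (2 * N) * of 0 := by
  have h : SemiconjBy (of 0) longGen (shortGen ^ 2) := by
    change of 0 * longGen = shortGen ^ 2 * of 0
    decide
  rw [pow_mul]
  exact (h.pow_right N).eq

/-! ### Exponential running time on the example. -/

section LowerBound

variable (P : ∀ b, CosetAlgorithm (fun i => ratioTwoHom b (of i)) (ratioTwoTransversal.set b))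

/-- The decomposition is unique, so every coset algorithm must return x and a word for (xy)^N. That
element has 2N letters and a generator supplies at most 4, so the word has at least N/2 letters,
reduced or not. -/
theorem rep_and_word_of_eq {b : Bool} {h : FreeGroup (Fin 2)} {N : ℕ}
    (hh : h = shortGen ^ N * of 0) :
    (P b).rep h = of 0 ∧ N ≤ 2 * ((P b).word h).length ∧
      evalWord (fun i => ratioTwoHom (!b) (of i)) ((P b).word h) = longGen ^ N := by
  have hspec := (P b).spec h
  rw [← map_evalWord (ratioTwoHom b) of] at hspec
  have hc : ratioTwoHom b (of (shortIndex b) ^ N) = shortGen ^ N := by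
    rw [map_pow, ratioTwoHom, lift_apply_of, ratioTwoGen_shortIndex]
  replace hspec := hspec.trans (hh.trans (congrArg (· * of 0) hc.symm))
  have hinj := (ratioTwoTransversal.compl b).injective
    (a₁ := ⟨⟨_, _, rfl⟩, ⟨_, (P b).rep_mem h⟩⟩)
    (a₂ := ⟨⟨_, of (shortIndex b) ^ N, rfl⟩, ⟨_, of_zero_mem_ratioTwoTransversal b⟩⟩) hspec
  have h1 : ratioTwoHom b (evalWord of ((P b).word h)) = ratioTwoHom b (of (shortIndex b) ^ N) :=
    congrArg (fun x => (x.1 : FreeGroup (Fin 2))) hinj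
  have h2 : (P b).rep h = of 0 := congrArg (fun x => (x.2 : FreeGroup (Fin 2))) hinj
  refine ⟨h2, ?_, ?_⟩
  · have h3 := norm_evalWord_le (fun i => ratioTwoHom b (of i)) ((P b).word h)
    have h4 := substLength_le (u := fun i => ratioTwoHom b (of i)) (U := 4) (by
      have : ∀ b i, (ratioTwoGen b i).norm ≤ 4 := by decide
      simpa only [ratioTwoHom, lift_apply_of] using this b) ((P b).word h)
    rw [← map_evalWord (ratioTwoHom b) of, h1, hc, norm_shortGen_pow] at h3
    lia
  · rw [← map_evalWord (ratioTwoHom (!b)) of, ratioTwoHom_injective b h1, map_pow, ratioTwoHom,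
      lift_apply_of, ratioTwoGen_not_shortIndex]

/-- The tail begins in the other factor, so x is put in front of it without a second split, and the
situation recurs with the factors exchanged. -/
theorem exists_le_run_cons {b : Bool} {g : FreeGroup (Fin 2)} {z : List (Fin 2 × Bool)} {N : ℕ}
    (h : g * evalWord (fun i => ratioTwoHom b (of i)) z = shortGen ^ N * of 0)
    (rest tail : List (Syllable fun _ => Fin 2)) (ht : ∀ t ∈ tail.head?, t.1 ≠ b) :
    ∃ n z' tail', N ≤ 2 * n ∧ (∀ t ∈ tail'.head?, t.1 ≠ !b) ∧
      evalWord (fun i => ratioTwoHom (!b) (of i)) z' = longGen ^ N ∧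
      n + (run P rest z' tail').2 ≤ (run P (⟨b, g⟩ :: rest) z tail).2 := by
  obtain ⟨h1, h2, h3⟩ := rep_and_word_of_eq P (b := b) h
  set y := g * evalWord (fun i => ratioTwoHom b (of i)) z with hy
  have hone : (P b).rep y ≠ 1 := by
    rw [h1]
    exact of_ne_one 0
  have htime := (P b).output_le_time y
  refine ⟨_, (P b).word y, ⟨b, (P b).rep y⟩ :: tail, h2, by simp, h3, ?_⟩
  match tail with
  | [] =>
    simp only [run, ← hy, hone, if_false]
    lia
  | ⟨b', t⟩ :: tail =>
    have hb : b' ≠ b := ht ⟨b', t⟩ (by simp)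
    simp only [run, ← hy, hone, if_false, dif_neg hb]
    lia

/-- The syllables `x, x, …, x`, taken alternately from the two factors. -/
def alternating : Bool → ℕ → List (Syllable fun _ => Fin 2)
  | _, 0 => []
  | b, k + 1 => ⟨b, of 0⟩ :: alternating (!b) k

theorem length_alternating (b : Bool) (k : ℕ) : (alternating b k).length = k := by
  induction k generalizing b with
  | zero => rfl
  | succ k ih => simp [alternating, ih]

theorem inputLength_alternating (b : Bool) (k : ℕ) : inputLength (alternating b k) = k := by
  induction k generalizing b with
  | zero => rfl
  | succ k ih =>
    have := ih (!b)
    simp only [alternating, inputLength, List.map_cons, List.sum_cons, norm_of] at this ⊢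
    lia

theorem isInput_cons_alternating (b : Bool) {g : FreeGroup (Fin 2)} (hg : g ≠ 1) (k : ℕ) :
    IsInput (X := fun _ => Fin 2) (⟨b, g⟩ :: alternating (!b) k) := by
  induction k generalizing b g with
  | zero => exact ⟨by simp [alternating], by simpa [alternating] using hg⟩
  | succ k ih =>
    obtain ⟨h1, h2⟩ := ih (!b) (of_ne_one 0)
    refine ⟨List.isChain_cons_cons.2 ⟨by simp, h1⟩, ?_⟩
    intro x hx
    rcases List.mem_cons.1 hx with rfl | hx
    · exact hg
    · exact h2 x hx

/-- Only the last of the k + 1 rounds is counted: there the exponent is 2^(k+1)·N, and half of it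
bounds the length of the word. -/
theorem le_run_alternating (k : ℕ) (b : Bool) (z : List (Fin 2 × Bool))
    (tail : List (Syllable fun _ => Fin 2)) (N : ℕ)
    (hz : evalWord (fun i => ratioTwoHom b (of i)) z = longGen ^ N)
    (ht : ∀ t ∈ tail.head?, t.1 ≠ b) : 2 ^ k * N ≤ (run P (alternating b (k + 1)) z tail).2 := by
  induction k generalizing b z tail N with
  | zero =>
    obtain ⟨n, z', tail', hn, -, -, hle⟩ := exists_le_run_cons P (N := 2 * N) (g := of 0)
      (by rw [hz, of_zero_mul_longGen_pow]) (alternating (!b) 0) tail ht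
    rw [alternating]
    lia
  | succ k ih =>
    obtain ⟨n, z', tail', hn, ht', hz', hle⟩ := exists_le_run_cons P (N := 2 * N) (g := of 0)
      (by rw [hz, of_zero_mul_longGen_pow]) (alternating (!b) (k + 1)) tail ht
    have := ih (!b) z' tail' (2 * N) hz' ht'
    rw [alternating, pow_succ, mul_assoc]
    lia

/-- The syllable treated at the beginning is xy·x, which creates c = xy; each further x doubles the
exponent. -/
theorem le_time_reverse_cons_alternating (k : ℕ) :
    2 ^ k ≤ 2 * time P (List.reverse (⟨false, shortGen * of 0⟩ :: alternating true k)) := by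
  rw [time, normalFormAlgorithm, List.reverse_reverse]
  obtain ⟨n, z', tail', hn, ht', hz', hle⟩ := exists_le_run_cons P (b := false) (z := []) (N := 1)
    (g := shortGen * of 0) (by simp) (alternating true k) [] (by simp)
  cases k with
  | zero => lia
  | succ k =>
    have := le_run_alternating P k true z' tail' 1 hz' ht'
    rw [pow_succ]
    lia

end LowerBound

end Example

end AmalgamNF

theorem theorem3p7 :
    -- (1)
    (∀ (X : Bool → Type*) [∀ b, DecidableEq (X b)] (C : Type*) [Group C]
      (φ : ∀ b, C →* FreeGroup (X b)) (_ : ∀ b, Function.Injective (φ b))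
      (ι : Type*) [Finite ι] (gen : ι → C) (_ : Subgroup.closure (Set.range gen) = ⊤),
      (∃ lam : ℝ, AmalgamNF.IsRewritingFactor φ lam) ∧
      (Nonempty ι → (∀ i, gen i ≠ 1) → AmalgamNF.NoCancellation φ gen →
        AmalgamNF.IsRewritingFactor φ (AmalgamNF.generatorRatio φ gen)) ∧
      (∃ d : Monoid.PushoutI.NormalWord.Transversal φ, AmalgamNF.IsMinimal d) ∧
      ∀ d : Monoid.PushoutI.NormalWord.Transversal φ, AmalgamNF.IsMinimal d →
        (∃ M : ℕ, AmalgamNF.IsOffset d M) ∧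
        (∃ (L : ℕ) (P : ∀ b, AmalgamNF.CosetAlgorithm (fun i => φ b (gen i)) (d.set b)),
          AmalgamNF.LinearTime P L) ∧
        ∀ L : ℕ, ∃ L₁ : ℝ, ∀ (lam : ℝ) (M : ℕ),
          AmalgamNF.IsRewritingFactor φ lam → AmalgamNF.IsOffset d M →
          ∃ E : ℝ, ∀ P : ∀ b, AmalgamNF.CosetAlgorithm (fun i => φ b (gen i)) (d.set b),
            AmalgamNF.LinearTime P L →
            ∀ w : List (AmalgamNF.Syllable X), AmalgamNF.IsInput w →
              (AmalgamNF.time P w : ℝ) ≤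
                w.length * L₁ * AmalgamNF.inputLength w * lam ^ w.length *
                  (AmalgamNF.inputLength w + M) ∧
              (AmalgamNF.time P w : ℝ) ≤ E ^ AmalgamNF.inputLength w) ∧
    -- (2)
    (∃ (n : Bool → ℕ) (m : ℕ) (φ : ∀ b, FreeGroup (Fin m) →* FreeGroup (Fin (n b)))
      (d : Monoid.PushoutI.NormalWord.Transversal φ) (lam : ℝ),
      AmalgamNF.IsMinimal d ∧ (∀ b, AmalgamNF.IsRecursive (d.set b)) ∧
      1 < lam ∧ AmalgamNF.IsRewritingFactor φ lam ∧
      ∃ (ε : ℝ) (K : ℕ), 0 < ε ∧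
        ∀ k : ℕ, 1 ≤ k → ∃ w : List (AmalgamNF.Syllable fun b => Fin (n b)),
          AmalgamNF.IsInput w ∧ w.length = k ∧ AmalgamNF.inputLength w ≤ K * k ∧
          ∀ P : ∀ b, AmalgamNF.CosetAlgorithm (fun i => φ b (FreeGroup.of i)) (d.set b),
            ε * lam ^ k ≤ (AmalgamNF.time P w : ℝ)) := by
  refine ⟨?_, ?_⟩
  · intro X _ C _ φ hφ ι _ gen hgen
    refine ⟨AmalgamNF.exists_isRewritingFactor hφ hgen, fun _ h1 h2 =>
      AmalgamNF.isRewritingFactor_generatorRatio hφ h1 h2, AmalgamNF.exists_isMinimal hφ,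
      fun d hd => ⟨AmalgamNF.exists_isOffset hd hgen, AmalgamNF.exists_linearTime hd hgen,
        fun L => ?_⟩⟩
    obtain ⟨N, hN⟩ := AmalgamNF.exists_norm_add_norm_le hd hgen
    obtain ⟨U, hU⟩ : ∃ U, ∀ b i, (φ b (gen i)).norm ≤ U := by
      choose U hU using fun b => AmalgamNF.exists_norm_le fun i => φ b (gen i)
      refine ⟨max (U false) (U true), fun b i => (hU b i).trans ?_⟩
      cases b <;> simp
    have hL₁ : (1 : ℝ) ≤ (2 + 2 * L + (1 + U) * (2 * L)) * (4 * N + 2) := by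
      have h1 : (1 : ℝ) ≤ 2 + 2 * L + (1 + U) * (2 * L) := by
        have : (0 : ℝ) ≤ 2 * L + (1 + U) * (2 * L) := by positivity
        linarith
      have h2 : (1 : ℝ) ≤ 4 * N + 2 := by
        have : (0 : ℝ) ≤ 4 * N := by positivity
        linarith
      exact one_le_mul_of_one_le_of_one_le h1 h2
    refine ⟨(2 + 2 * L + (1 + U) * (2 * L)) * (4 * N + 2), fun lam M hlam _ =>
      ⟨8 * ((2 + 2 * L + (1 + U) * (2 * L)) * (4 * N + 2)) * lam * (1 + M), fun P hP w hw => ?_⟩⟩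
    have key := AmalgamNF.time_le P hP hU
      (fun b s hs z => by
        rw [← AmalgamNF.map_evalWord]
        exact hd b s hs _)
      (fun b s hs z => by
        rw [← AmalgamNF.map_evalWord]
        exact hN b s hs _)
      hlam.1
      (fun b z => by
        rw [← AmalgamNF.map_evalWord, ← AmalgamNF.map_evalWord]
        exact hlam.2 b _)
      hw M
    have hk := AmalgamNF.length_le_inputLength hw.2
    exact ⟨key, key.trans (AmalgamNF.polynomial_mul_pow_le_pow hk (by lia) M hL₁ hlam.1)⟩
  -- An input with k + 1 syllables has length k + 3 ≤ 3(k + 1) and takes at least 2^k/2 = 2^(k+1)/4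
  -- steps, whence ε = 1/4 and K = 3.
  · refine ⟨fun _ => 2, 2, AmalgamNF.ratioTwoHom, AmalgamNF.ratioTwoTransversal, 2,
      AmalgamNF.isMinimal_ratioTwoTransversal, AmalgamNF.isRecursive_ratioTwoTransversal,
      one_lt_two, AmalgamNF.isRewritingFactor_ratioTwoHom, 1 / 4, 3, by norm_num, ?_⟩
    intro k hk
    obtain ⟨k, rfl⟩ := Nat.exists_eq_add_of_le' hk
    have hin := AmalgamNF.isInput_cons_alternating false
      (g := AmalgamNF.shortGen * FreeGroup.of 0) (by decide) k
    refine ⟨_, ⟨List.isChain_reverse.2 (hin.1.imp fun _ _ h => h.symm),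
      fun x hx => hin.2 x (List.mem_reverse.1 hx)⟩, ?_, ?_, fun P => ?_⟩
    · rw [List.length_reverse, List.length_cons, AmalgamNF.length_alternating]
    · have h := AmalgamNF.inputLength_alternating true k
      have h3 : (AmalgamNF.shortGen * FreeGroup.of 0).norm = 3 := by decide
      simp only [AmalgamNF.inputLength, List.map_reverse, List.sum_reverse, List.map_cons,
        List.sum_cons, Bool.not_false] at h ⊢
      rw [h, h3]
      lia
    · have h : (2 : ℝ) ^ k ≤ 2 * (AmalgamNF.time P (List.reverse (⟨false,
          AmalgamNF.shortGen * FreeGroup.of 0⟩ :: AmalgamNF.alternating true k)) : ℝ) :=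
        mod_cast AmalgamNF.le_time_reverse_cons_alternating P k
      rw [pow_succ]
      refine le_trans ?_ ((div_le_iff₀' two_pos).2 h)
      linarith
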